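/- All graphs are finite, simple, undirected and connected. Let $G\le\operatorname{Aut}(\Gamma)$. The graph $\Gamma$ is $(G,2)$-arc-transitive if $G$ is transitive on the triples of vertices $(\alpha,\beta,\gamma)$ with $\alpha\sim\beta\sim\gamma$ and $\alpha\neq\gamma$. The pair $(\Gamma,G)$ is locally-$S_m$ if $G$ is vertex-transitive and, for every vertex $\alpha$, there are exactly $m$ neighbours of $\alpha$ and the stabilizer $G_\alpha$ induces on them the full symmetric group $S_m$. A $G$-permutable $m$-matching is a set $\mathcal M$ of $m$ pairwise disjoint edges such that the setwise stabilizer of $\mathcal M$ in $G$ induces the full symmetric group on $\mathcal M$; a permutable $m$-matching is an $\operatorname{Aut}(\Gamma)$-permutable one. For $N\trianglelefteq G$, the normal quotient $\Gamma_N$ has the $N$-orbits on vertices as its vertices, two distinct orbits being adjacent if and only if some edge of $\Gamma$ joins them. **Corollary 3.10.** Let $m\ge 3$. There are infinitely many (pairwise non-isomorphic) graphs $\Gamma$ with a group $G\le\operatorname{Aut}(\Gamma)$ such that 1. $\Gamma$ is $(G,2)$-arc-transitive, 2. $(\Gamma,G)$ is locally-$S_m$, 3. $\Gamma$ contains a $G$-permutable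 $m$-matching, and 4. $G$ has a nontrivial normal subgroup $N$ with more than two orbits on $V(\Gamma)$ such that $\Gamma_N$ has no permutable $m$-matching (in particular none with respect to the group that $G$ induces on $\Gamma_N$). Moreover, infinitely many such $\Gamma$, $G$, $N$ can be found with $\Gamma$ a regular cover of $\Delta$ whose group of covering transformations is $N$, where $N$ is an elementary abelian $q$-group for some prime $q$ (so that $\Gamma_N\cong\Delta$), for each of the following graphs $\Delta$: the complete graph $K_{m+1}$ (for every $m\ge 3$); the $m$-dimensional hypercube $Q_m$ (for every $m\ge 5$); the folded $m$-dimensional hypercube, obtained from $Q_m$ by identifying antipodal vertices (for every $m\ge 3$ with $m\ne 4$). Here a regular cover of $\Delta$ is a graph $\Gamma$ with a surjection $V(\Gamma)\to V(\Delta)$ that maps the neighbours of each vertex bijectively onto the neighbours of its image, such that the covering transformations, i.e. the automorphisms of $\Gamma$ preserving every fibre, act regularly on each fibre. -/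

import Mathlib

namespace PermMatch

/-- An `s`-arc of `Γ`: vertices `a 0, …, a s`, consecutive ones adjacent, with `a i ≠ a (i + 2)`. -/
def IsSArc {V : Type*} (Γ : SimpleGraph V) (s : ℕ) (a : Fin (s + 1) → V) : Prop :=
  (∀ i : Fin s, Γ.Adj (a i.castSucc) (a i.succ)) ∧
  ∀ i j : Fin (s + 1), (i : ℕ) + 2 = j → a i ≠ a j

/-- `Γ` is `(G,s)`-arc-transitive, for `G ≤ Aut Γ`: `G` is transitive on the `s`-arcs of `Γ`. -/
def IsSArcTransitive {V : Type*} (Γ : SimpleGraph V) (G : Subgroup (Γ ≃g Γ)) (s : ℕ) : Prop :=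
  ∀ a b : Fin (s + 1) → V, IsSArc Γ s a → IsSArc Γ s b → ∃ g ∈ G, ∀ i, g (a i) = b i

/-- `(Γ,G)` is locally-`S_m`: `G` is vertex-transitive and, for every vertex `α`, the group induced
by the stabilizer `G_α` on the set `Γ(α)` of neighbours is the symmetric group on `m` points, i.e.
`|Γ(α)| = m` and every permutation of `Γ(α)` is induced by an element of `G_α`. -/
def IsLocallySym {V : Type*} (Γ : SimpleGraph V) (G : Subgroup (Γ ≃g Γ)) (m : ℕ) : Prop :=
  (∀ α β : V, ∃ g ∈ G, g α = β) ∧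
  ∀ α : V, (Γ.neighborSet α).ncard = m ∧
    ∀ σ : Equiv.Perm (Γ.neighborSet α), ∃ g ∈ G, g α = α ∧
      ∀ β : Γ.neighborSet α, g (β : V) = (σ β : V)

/-- `Γ` contains a `G`-permutable `m`-matching, for `G ≤ Aut Γ`: a matching `M` with exactly `m`
edges such that every permutation of the edges of `M` is induced by an element of `G`. -/
def HasPermutableMatching {V : Type*} (Γ : SimpleGraph V) (G : Subgroup (Γ ≃g Γ)) (m : ℕ) : Prop :=
  ∃ M : Γ.Subgraph, M.IsMatching ∧ M.edgeSet.ncard = m ∧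
    ∀ σ : Equiv.Perm M.edgeSet, ∃ g ∈ G,
      ∀ e : M.edgeSet, Sym2.map g (e : Sym2 V) = (σ e : Sym2 V)

/-- The quotient graph of `Γ` with respect to a partition of its vertices: distinct blocks are
adjacent if and only if they contain adjacent representatives. -/
def quotientGraph {V : Type*} (Γ : SimpleGraph V) (r : Setoid V) : SimpleGraph (Quotient r) where
  Adj A B := A ≠ B ∧ ∃ a b : V, Quotient.mk r a = A ∧ Quotient.mk r b = B ∧ Γ.Adj a b
  symm := ⟨fun _ _ ⟨hne, a, b, ha, hb, hab⟩ => ⟨hne.symm, b, a, hb, ha, hab.symm⟩⟩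
  loopless := ⟨fun _ h => h.1 rfl⟩

/-- The normal quotient graph `Γ_N`: the quotient of `Γ` by the partition into `N`-orbits. -/
def normalQuotient {V : Type*} (Γ : SimpleGraph V) (N : Subgroup (Γ ≃g Γ)) :
    SimpleGraph (MulAction.orbitRel.Quotient N V) :=
  quotientGraph Γ (MulAction.orbitRel N V)

/-- `Γ` is a connected `(G,2)`-arc-transitive, locally-`S_m` graph with a `G`-permutable
`m`-matching, and `N` is a nontrivial normal subgroup of `G` with more than two vertex orbits, such
that `Γ_N` has no permutable `m`-matching, not even with respect to its full automorphism group. -/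
structure LosesPermutableMatching {V : Type*} (m : ℕ) (Γ : SimpleGraph V)
    (G N : Subgroup (Γ ≃g Γ)) : Prop where
  connected : Γ.Connected
  twoArcTransitive : IsSArcTransitive Γ G 2
  locallySym : IsLocallySym Γ G m
  hasMatching : HasPermutableMatching Γ G m
  le : N ≤ G
  normal : (N.subgroupOf G).Normal
  nontrivial : N ≠ ⊥
  orbits : 2 < Nat.card (MulAction.orbitRel.Quotient N V)
  quotient_noMatching : ¬ HasPermutableMatching (normalQuotient Γ N) ⊤ m

/-- A covering projection of graphs: a surjective map on vertices that maps the neighbours of each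
vertex `v` bijectively onto the neighbours of the image of `v`. -/
def IsCoveringProjection {V W : Type*} (Γ : SimpleGraph V) (Δ : SimpleGraph W) (p : V → W) : Prop :=
  Function.Surjective p ∧ ∀ v, Set.BijOn p (Γ.neighborSet v) (Δ.neighborSet (p v))

/-- `Γ` is a regular cover of `Δ` whose group of covering transformations is the elementary
abelian group `N`: the covering transformations (the automorphisms of `Γ` that preserve every fibre)
act regularly on each fibre, they form the group `N`, and `N` is an elementary abelian `q`-group for
some prime `q`. -/
def IsElementaryAbelianCover {V W : Type*} (Γ : SimpleGraph V) (N : Subgroup (Γ ≃g Γ))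
    (Δ : SimpleGraph W) : Prop :=
  ∃ p : V → W, IsCoveringProjection Γ Δ p ∧
    (∀ g : Γ ≃g Γ, g ∈ N ↔ ∀ v, p (g v) = p v) ∧
    (∀ v w : V, p v = p w → ∃! g : Γ ≃g Γ, g ∈ N ∧ g v = w) ∧
    (∀ g ∈ N, ∀ h ∈ N, g * h = h * g) ∧
    ∃ q : ℕ, q.Prime ∧ ∀ g ∈ N, g ^ q = 1

/-- The `m`-dimensional hypercube `Q_m`. -/
def hypercube (m : ℕ) : SimpleGraph (Fin m → Bool) where
  Adj x y := hammingDist x y = 1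
  symm := ⟨fun x y h => by rw [hammingDist_comm]; exact h⟩
  loopless := ⟨fun x h => by simp at h⟩

/-- The partition of the vertices of `Q_m` into antipodal pairs. -/
def antipodal (m : ℕ) : Setoid (Fin m → Bool) where
  r x y := y = x ∨ ∀ i, y i = !(x i)
  iseqv :=
    { refl := fun _ => Or.inl rfl
      symm := by
        rintro x y (h | h)
        · exact Or.inl h.symm
        · exact Or.inr fun i => by simp [h i]
      trans := by
        rintro x y z (rfl | h) (rfl | k)
        · exact Or.inl rfl
        · exact Or.inr k
        · exact Or.inr h
        · exact Or.inl (funext fun i => by simp [h i, k i]) }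

/-- The folded `m`-dimensional hypercube: `Q_m` with antipodal vertices identified. -/
def foldedCube (m : ℕ) : SimpleGraph (Quotient (antipodal m)) :=
  quotientGraph (hypercube m) (antipodal m)

end PermMatch

/-!
The graph `Γ` is a voltage cover of `Δ`, for a large prime `q`. Let `Z` be the space of flows of `Δ`
with values in `ZMod q`, and let `N` be its dual. The vertices of `Γ` are the pairs of a vertex of
`Δ` and an element of `N`, and an edge from `u` to `v` carries the voltage `ζ u v` in `N` that
evaluates each flow on it (`flowVoltage`). These voltages are transformed by `Aut Δ` through its
linear action on `N`, without any correction by coboundaries, so the semidirect product of `N` and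
`Aut Δ` acts on `Γ`. In particular every automorphism of `Δ` lifts, and `Γ` inherits local symmetry and 2-arc-transitivity
(`losesPermutableMatching_of_cover`).

*Connectedness.* If the voltages of closed walks do not fill `N`, a nonzero functional on `N`
vanishes on them. It is a nonzero flow that is also the gradient of a function, and this function is
harmonic. For all but finitely many `q` the harmonic functions modulo `q` on a connected graph are
constant (`exists_forall_harmonic_const`), a contradiction.

*The matching in `Γ`.* Fix a vertex `α` of `Δ`. The edges from `(α, -ζ α β)` to `(β, 0)`, for the `m`
neighbours `β` of `α`, are permuted as the symmetric group by the lifts of the stabilizer of `α`.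
They are pairwise disjoint because the voltages `ζ α β` are distinct, which the flows around
`4`-cycles detect (`flowVoltage_ne`, `hasPermutableMatching_voltageGraph`).

*No matching in `Δ`.* For `K_{m+1}`, and for the folded `3`-cube, which has four vertices, there are
too few vertices. For the other cubes and folded cubes with `m ≥ 5`, every automorphism permutes the
`m` coordinate flips (`IsFlipGraph.exists_perm`). On a permutable `m`-matching the automorphisms
commuting with all flips act trivially, since the symmetric group on at least five points has no
nontrivial abelian normal subgroup. It follows that the `m` edges lie in the `m` different
directions, compatibly with the action on the flips, and an automorphism exchanging two directions
and fixing the others forces the two corresponding edges to meet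
(`IsFlipGraph.not_hasPermutableMatching`).
-/

namespace PermMatch

/-! ### Permutable matchings as indexed families of edges -/

/-- `s(a i, b i)`, for `i : Fin m`, are `m` pairwise disjoint edges of `Γ`, and every permutation of
the indices is induced by an element of `G`. This is a permutable matching together with an
enumeration of its edges and an orientation of each of them. -/
structure IsPermutableFamily {V : Type*} (Γ : SimpleGraph V) (G : Subgroup (Γ ≃g Γ)) {m : ℕ}
    (a b : Fin m → V) : Prop where
  adj : ∀ i, Γ.Adj (a i) (b i)
  disjoint : ∀ i j, i ≠ j → a i ≠ a j ∧ b i ≠ b j ∧ a i ≠ b j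
  perm : ∀ π : Equiv.Perm (Fin m), ∃ g ∈ G, ∀ i, s(g (a i), g (b i)) = s(a (π i), b (π i))

theorem HasPermutableMatching.exists_family {V : Type*} {Γ : SimpleGraph V}
    {G : Subgroup (Γ ≃g Γ)} {m : ℕ} (hm : m ≠ 0) (h : HasPermutableMatching Γ G m) :
    ∃ a b : Fin m → V, IsPermutableFamily Γ G a b := by
  obtain ⟨M, hM, hcard, hperm⟩ := h
  have : Finite M.edgeSet := Set.finite_of_ncard_ne_zero (hcard ▸ hm)
  let e : Fin m ≃ M.edgeSet := (Finite.equivFinOfCardEq hcard).symm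
  have hex : ∀ i, ∃ p : V × V, (e i : Sym2 V) = s(p.1, p.2) := fun i => by
    induction (e i : Sym2 V) with | _ x y => exact ⟨(x, y), rfl⟩
  choose p hp using hex
  have hadj : ∀ i, M.Adj (p i).1 (p i).2 := fun i => by
    rw [← SimpleGraph.Subgraph.mem_edgeSet, ← hp]; exact (e i).2
  have hinj : ∀ i j, s((p i).1, (p i).2) = s((p j).1, (p j).2) → i = j := fun i j hij =>
    e.injective (Subtype.ext (by rw [hp, hp, hij]))
  refine ⟨fun i => (p i).1, fun i => (p i).2, fun i => (hadj i).adj_sub, fun i j hij => ?_,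
    fun π => ?_⟩
  · refine ⟨fun h => hij (hinj i j ?_), fun h => hij (hinj i j ?_), fun h => hij (hinj i j ?_)⟩
    · have h1 := hadj j
      rw [← h] at h1
      rw [← h, hM.eq_of_adj_left (hadj i) h1]
    · have h1 := hadj j
      rw [← h] at h1
      rw [← h, hM.eq_of_adj_right (hadj i) h1]
    · have h1 := (hadj j).symm
      rw [← h] at h1
      rw [← h, hM.eq_of_adj_left (hadj i) h1, Sym2.eq_swap]
  · obtain ⟨g, hg, hg'⟩ := hperm ((e.symm.trans π).trans e)
    refine ⟨g, hg, fun i => ?_⟩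
    have := hg' (e i)
    simpa [hp] using this

theorem IsPermutableFamily.hasPermutableMatching {V : Type*} {Γ : SimpleGraph V}
    {G : Subgroup (Γ ≃g Γ)} {m : ℕ} {a b : Fin m → V} (h : IsPermutableFamily Γ G a b) :
    HasPermutableMatching Γ G m := by
  have hinj : Function.Injective fun i => s(a i, b i) := fun i j hij => by
    by_contra hne
    have := h.disjoint i j hne
    rcases Sym2.eq_iff.1 hij with h' | h'
    · exact this.1 h'.1
    · exact this.2.2 h'.1
  have hset : (⨆ i, Γ.subgraphOfAdj (h.adj i)).edgeSet = Set.range fun i => s(a i, b i) := by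
    ext x
    simp [SimpleGraph.Subgraph.edgeSet_iSup, eq_comm]
  refine ⟨⨆ i, Γ.subgraphOfAdj (h.adj i), ?_, ?_, ?_⟩
  · refine SimpleGraph.Subgraph.IsMatching.iSup
      (fun i => SimpleGraph.Subgraph.IsMatching.subgraphOfAdj (h.adj i)) fun i j hij => ?_
    have h1 := h.disjoint i j hij
    have h2 := h.disjoint j i hij.symm
    simpa using And.intro ⟨h2.1, h2.2.2⟩ ⟨h1.2.2.symm, h2.2.1⟩
  · rw [hset, Set.ncard_range_of_injective hinj, Nat.card_eq_fintype_card, Fintype.card_fin]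
  · rw [hset]
    intro σ
    let e : Fin m ≃ Set.range fun i => s(a i, b i) := Equiv.ofInjective _ hinj
    obtain ⟨g, hg, hg'⟩ := h.perm ((e.trans σ).trans e.symm)
    refine ⟨g, hg, fun x => ?_⟩
    obtain ⟨i, rfl⟩ := e.surjective x
    have h1 : ∀ j, (e j : Sym2 V) = s(a j, b j) := fun j => rfl
    rw [h1, Sym2.map_mk, hg', ← h1]
    simp

/-- The image of a permutable matching under a graph isomorphism is a permutable matching. -/
theorem HasPermutableMatching.map_iso {V W : Type*} {Γ : SimpleGraph V} {Δ : SimpleGraph W}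
    (φ : Γ ≃g Δ) {m : ℕ} (hm : m ≠ 0) (h : HasPermutableMatching Γ ⊤ m) :
    HasPermutableMatching Δ ⊤ m := by
  obtain ⟨a, b, hab⟩ := h.exists_family hm
  refine IsPermutableFamily.hasPermutableMatching (a := φ ∘ a) (b := φ ∘ b)
    ⟨fun i => φ.map_adj_iff.2 (hab.adj i), fun i j hij => ?_, fun π => ?_⟩
  · simpa using hab.disjoint i j hij
  · obtain ⟨g, -, hg⟩ := hab.perm π
    refine ⟨(φ.symm.trans g).trans φ, Subgroup.mem_top _, fun i => ?_⟩
    simpa using congrArg (Sym2.map φ) (hg i)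

theorem HasPermutableMatching.two_mul_le_card {V : Type*} [Finite V] {Γ : SimpleGraph V}
    {G : Subgroup (Γ ≃g Γ)} {m : ℕ} (hm : m ≠ 0) (h : HasPermutableMatching Γ G m) :
    2 * m ≤ Nat.card V := by
  obtain ⟨a, b, hab⟩ := h.exists_family hm
  have hinj : Function.Injective (Sum.elim a b) := by
    refine Function.Injective.sumElim ?_ ?_ fun i j => ?_
    · exact fun i j hij => by_contra fun hne => (hab.disjoint i j hne).1 hij
    · exact fun i j hij => by_contra fun hne => (hab.disjoint i j hne).2.1 hij
    · rcases eq_or_ne i j with rfl | hne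
      · exact (hab.adj i).ne
      · exact (hab.disjoint i j hne).2.2
  have := Nat.card_le_card_of_injective _ hinj
  rwa [Nat.card_sum, Nat.card_fin, ← two_mul] at this

/-! ### Local symmetry and 2-arc-transitivity -/

theorem exists_perm_apply_eq_pair {S : Type*} {a b c d : S} (hab : a ≠ b) (hcd : c ≠ d) :
    ∃ σ : Equiv.Perm S, σ a = c ∧ σ b = d := by
  classical
  have h : Equiv.swap a c b ≠ c := fun h => hab.symm (by
    exact (Equiv.swap a c).injective (h.trans (Equiv.swap_apply_left a c).symm))
  refine ⟨Equiv.swap (Equiv.swap a c b) d * Equiv.swap a c, ?_, ?_⟩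
  · rw [Equiv.Perm.mul_apply, Equiv.swap_apply_left, Equiv.swap_apply_of_ne_of_ne h.symm hcd]
  · rw [Equiv.Perm.mul_apply, Equiv.swap_apply_left]

theorem IsLocallySym.isSArcTransitive_two {V : Type*} {Γ : SimpleGraph V}
    {G : Subgroup (Γ ≃g Γ)} {m : ℕ} (h : IsLocallySym Γ G m) : IsSArcTransitive Γ G 2 := by
  intro a b ha hb
  have ha1 := ha.1 0
  have ha2 := ha.1 1
  have ha3 := ha.2 0 2 rfl
  have hb1 := hb.1 0
  have hb2 := hb.1 1
  have hb3 := hb.2 0 2 rfl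
  simp only [Fin.isValue, Fin.castSucc_zero, Fin.succ_zero_eq_one, Fin.castSucc_one,
    Fin.succ_one_eq_two] at ha1 ha2 hb1 hb2
  obtain ⟨g, hg, hg1⟩ := h.1 (a 1) (b 1)
  have hn0 : Γ.Adj (b 1) (g (a 0)) := hg1 ▸ g.map_adj_iff.2 ha1.symm
  have hn2 : Γ.Adj (b 1) (g (a 2)) := hg1 ▸ g.map_adj_iff.2 ha2
  obtain ⟨σ, h0, h2⟩ := exists_perm_apply_eq_pair
    (a := (⟨g (a 0), hn0⟩ : Γ.neighborSet (b 1))) (b := ⟨g (a 2), hn2⟩)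
    (c := ⟨b 0, hb1.symm⟩) (d := ⟨b 2, hb2⟩)
    (fun h => ha3 (g.injective (congrArg Subtype.val h))) fun h => hb3 (congrArg Subtype.val h)
  obtain ⟨k, hk, hk1, hk'⟩ := (h.2 (b 1)).2 σ
  refine ⟨k * g, G.mul_mem hk hg, fun i => ?_⟩
  fin_cases i
  · simpa [h0] using hk' ⟨g (a 0), hn0⟩
  · simp [RelIso.mul_apply, hg1, hk1]
  · simpa [h2] using hk' ⟨g (a 2), hn2⟩

/-! ### Covering transformations and fibre-preserving automorphisms -/

section Cover

variable {X W : Type*} {Γ : SimpleGraph X} {Δ : SimpleGraph W} {p : X → W} {m : ℕ}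

/-- The automorphisms of `Γ` that permute the fibres of `p`. -/
def fibreGroup (Γ : SimpleGraph X) (p : X → W) : Subgroup (Γ ≃g Γ) where
  carrier := {h | ∀ x y, p (h x) = p (h y) ↔ p x = p y}
  mul_mem' {g h} hg hh x y := (hg _ _).trans (hh x y)
  one_mem' _ _ := Iff.rfl
  inv_mem' {g} hg x y := by
    rw [← hg, RelIso.apply_inv_self, RelIso.apply_inv_self]

/-- The automorphisms of `Γ` that preserve every fibre of `p`, i.e. the covering transformations
when `p` is a covering projection. -/
def deckGroup (Γ : SimpleGraph X) (p : X → W) : Subgroup (Γ ≃g Γ) where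
  carrier := {h | ∀ x, p (h x) = p x}
  mul_mem' {g h} hg hh x := (hg _).trans (hh x)
  one_mem' _ := rfl
  inv_mem' {g} hg x := by
    rw [← hg, RelIso.apply_inv_self]

/-- A lift of an automorphism of the base permutes the fibres. -/
theorem mem_fibreGroup_of_lift {h : Γ ≃g Γ} {g : Δ ≃g Δ} (hg : ∀ x, p (h x) = g (p x)) :
    h ∈ fibreGroup Γ p := fun x y => by
  rw [hg, hg, g.injective.eq_iff]

theorem deckGroup_le_fibreGroup : deckGroup Γ p ≤ fibreGroup Γ p := fun h hh x y => by
  rw [hh, hh]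

theorem deckGroup_normal : ((deckGroup Γ p).subgroupOf (fibreGroup Γ p)).Normal := by
  refine ⟨fun n hn g => ?_⟩
  rw [Subgroup.mem_subgroupOf] at hn ⊢
  intro x
  have h1 : p ((g : Γ ≃g Γ) ((n : Γ ≃g Γ) ((g : Γ ≃g Γ)⁻¹ x)))
      = p ((g : Γ ≃g Γ) ((g : Γ ≃g Γ)⁻¹ x)) := (g.2 _ _).2 (hn _)
  rwa [RelIso.apply_inv_self] at h1

/-- A property of vertices that holds somewhere and propagates along edges holds everywhere. -/
theorem forall_of_connected (hΓ : Γ.Connected) {P : X → Prop} (x : X) (hx : P x)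
    (h : ∀ y z, Γ.Adj y z → P y → P z) (y : X) : P y := by
  obtain ⟨w⟩ := hΓ.preconnected x y
  induction w with
  | nil => exact hx
  | cons hadj w ih => exact ih (h _ _ hadj hx)

/-- Unique lifting: automorphisms of a connected cover with the same projection agree if they agree
at a vertex. -/
theorem eq_of_lifts_agree (hp : IsCoveringProjection Γ Δ p) (hΓ : Γ.Connected) {h k : Γ ≃g Γ}
    (hhk : ∀ x, p (h x) = p (k x)) {x : X} (hx : h x = k x) : h = k := by
  refine RelIso.ext (forall_of_connected hΓ (P := fun x => h x = k x) x hx fun y z hyz hy => ?_)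
  refine (hp.2 (h y)).injOn (h.map_adj_iff.2 hyz) ?_ (hhk z)
  exact hy ▸ k.map_adj_iff.2 hyz

theorem isLocallySym_fibreGroup (hp : IsCoveringProjection Γ Δ p) (hΔ : IsLocallySym Δ ⊤ m)
    (hlift : ∀ (g : Δ ≃g Δ) (x y : X), p y = g (p x) →
      ∃ h : Γ ≃g Γ, (∀ z, p (h z) = g (p z)) ∧ h x = y) :
    IsLocallySym Γ (fibreGroup Γ p) m := by
  refine ⟨fun x y => ?_, fun x => ⟨?_, fun σ => ?_⟩⟩
  · obtain ⟨g, -, hg⟩ := hΔ.1 (p x) (p y)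
    obtain ⟨h, hh, hxy⟩ := hlift g x y hg.symm
    exact ⟨h, mem_fibreGroup_of_lift hh, hxy⟩
  · rw [← (hΔ.2 (p x)).1, ← (hp.2 x).image_eq, (hp.2 x).injOn.ncard_image]
  · let e : Γ.neighborSet x ≃ Δ.neighborSet (p x) := (hp.2 x).equiv
    have he : ∀ y, (e y : W) = p y := fun y => rfl
    obtain ⟨g, -, hgx, hg⟩ := (hΔ.2 (p x)).2 ((e.symm.trans σ).trans e)
    obtain ⟨h, hh, hx⟩ := hlift g x x hgx.symm
    refine ⟨h, mem_fibreGroup_of_lift hh, hx, fun y => ?_⟩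
    refine (hp.2 x).injOn ?_ (σ y).2 ?_
    · have : Γ.Adj (h x) (h y) := h.map_adj_iff.2 y.2
      rwa [hx] at this
    · rw [hh, ← he, ← he, hg]
      simp

/-- If the covering transformations are transitive on the fibres, the base is the normal quotient
of the cover by them. -/
theorem exists_iso_normalQuotient_deckGroup (hp : IsCoveringProjection Γ Δ p)
    (htrans : ∀ x y, p x = p y → ∃ h ∈ deckGroup Γ p, h x = y) :
    Nonempty (normalQuotient Γ (deckGroup Γ p) ≃g Δ) := by
  have hrel : ∀ x y, (MulAction.orbitRel (deckGroup Γ p) X).r x y ↔ p x = p y := fun x y => by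
    refine ⟨?_, fun hxy => ?_⟩
    · rintro ⟨h, rfl⟩
      exact h.2 y
    · obtain ⟨h, hh, hx⟩ := htrans y x hxy.symm
      exact ⟨⟨h, hh⟩, hx⟩
  let f : MulAction.orbitRel.Quotient (deckGroup Γ p) X → W :=
    Quotient.lift p fun x y hxy => (hrel x y).1 hxy
  have hf : Function.Bijective f := by
    refine ⟨fun A B => ?_, fun w => ?_⟩
    · induction A, B using Quotient.inductionOn₂ with
      | _ x y => exact fun hxy => Quotient.sound ((hrel x y).2 hxy)
    · obtain ⟨x, rfl⟩ := hp.1 w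
      exact ⟨Quotient.mk _ x, rfl⟩
  refine ⟨⟨Equiv.ofBijective f hf, fun {A B} => ?_⟩⟩
  simp only [Equiv.ofBijective_apply]
  constructor
  · intro hAB
    refine ⟨fun h => hAB.ne (congrArg f h), ?_⟩
    induction A, B using Quotient.inductionOn₂ with
    | _ x y =>
      obtain ⟨z, hz, hzy⟩ := (hp.2 x).surjOn hAB
      exact ⟨x, z, rfl, Quotient.sound ((hrel z y).2 hzy), hz⟩
  · rintro ⟨-, x, y, rfl, rfl, hxy⟩
    exact (hp.2 x).mapsTo hxy

/-- A cover along which every automorphism of the base lifts inherits local symmetry. If the cover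
has a permutable matching and the base has none, the matching is lost in the normal quotient. -/
theorem losesPermutableMatching_of_cover [Finite W] (hm : 3 ≤ m)
    (hp : IsCoveringProjection Γ Δ p) (hΓ : Γ.Connected) (hΔ : IsLocallySym Δ ⊤ m)
    (hlift : ∀ (g : Δ ≃g Δ) (x y : X), p y = g (p x) →
      ∃ h : Γ ≃g Γ, (∀ z, p (h z) = g (p z)) ∧ h x = y)
    (hM : HasPermutableMatching Γ (fibreGroup Γ p) m) (hno : ¬ HasPermutableMatching Δ ⊤ m)
    (hne : ∃ x y, x ≠ y ∧ p x = p y) :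
    LosesPermutableMatching m Γ (fibreGroup Γ p) (deckGroup Γ p) := by
  have htrans : ∀ x y, p x = p y → ∃ h ∈ deckGroup Γ p, h x = y := fun x y hxy =>
    hlift 1 x y hxy.symm
  obtain ⟨φ⟩ := exists_iso_normalQuotient_deckGroup hp htrans
  have hsym := isLocallySym_fibreGroup hp hΔ hlift
  refine ⟨hΓ, hsym.isSArcTransitive_two, hsym, hM, deckGroup_le_fibreGroup, deckGroup_normal,
    ?_, ?_, fun h => hno (h.map_iso φ (by omega))⟩
  · obtain ⟨x, y, hxy, hpxy⟩ := hne
    obtain ⟨h, hh, hx⟩ := htrans x y hpxy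
    intro hbot
    rw [hbot, Subgroup.mem_bot] at hh
    exact hxy (by rw [← hx, hh]; rfl)
  · obtain ⟨x, -⟩ := hne
    rw [Nat.card_congr φ.toEquiv]
    calc 2 < m := hm
      _ = (Δ.neighborSet (p x)).ncard := (hΔ.2 (p x)).1.symm
      _ ≤ Nat.card W := Set.ncard_le_card _

end Cover

/-! ### Covers from equivariant voltages -/

section Voltage

variable {X W N : Type*} [AddCommGroup N] {Δ : SimpleGraph W} {ζ : W → W → N} {m : ℕ}

/-- The cover of `Δ` with voltages `ζ` in `N`: the vertices are the pairs `(v, t)` in `W × N`, and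
for adjacent `u` and `v` the vertex `(u, t)` is joined to `(v, t + ζ u v)`. The vertices are
relabelled by a type `X` in bijection with `W × N`. -/
def voltageGraph (Δ : SimpleGraph W) (ζ : W → W → N) (hζ : ∀ u v, ζ v u = -ζ u v)
    (e : X ≃ W × N) : SimpleGraph X where
  Adj x y := Δ.Adj (e x).1 (e y).1 ∧ (e y).2 = (e x).2 + ζ (e x).1 (e y).1
  symm := ⟨fun x y ⟨h, h'⟩ => ⟨h.symm, by rw [h', hζ]; abel⟩⟩
  loopless := ⟨fun _ h => h.1.ne rfl⟩

variable (hζ : ∀ u v, ζ v u = -ζ u v) (e : X ≃ W × N)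

theorem voltageGraph_adj_symm_apply {u v : W} {s t : N} :
    (voltageGraph Δ ζ hζ e).Adj (e.symm (u, s)) (e.symm (v, t)) ↔
      Δ.Adj u v ∧ t = s + ζ u v := by
  simp [voltageGraph]

theorem isCoveringProjection_voltageGraph :
    IsCoveringProjection (voltageGraph Δ ζ hζ e) Δ fun x => (e x).1 := by
  refine ⟨fun w => ⟨e.symm (w, 0), by simp⟩, fun x => ⟨fun y hy => hy.1, ?_, fun w hw => ?_⟩⟩
  · intro y hy z hz hyz
    refine e.injective (Prod.ext hyz ?_)
    dsimp only at hyz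
    rw [hy.2, hz.2, hyz]
  · exact ⟨e.symm (w, (e x).2 + ζ (e x).1 w), by simpa [voltageGraph] using hw, by simp⟩

/-- An automorphism `g` of the base under which the voltages transform by `θ`, combined with a
translation by `t`, acts on the voltage cover. -/
def voltageLift (g : Δ ≃g Δ) (θ : N ≃+ N) (h : ∀ u v, ζ (g u) (g v) = θ (ζ u v)) (t : N) :
    voltageGraph Δ ζ hζ e ≃g voltageGraph Δ ζ hζ e where
  toEquiv := (e.trans (g.toEquiv.prodCongr (θ.toEquiv.trans (Equiv.addRight t)))).trans e.symm
  map_rel_iff' {x y} := by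
    simp only [voltageGraph, Equiv.trans_apply, Equiv.apply_symm_apply, Equiv.prodCongr_apply,
      Prod.map_fst, Prod.map_snd, RelIso.coe_fn_toEquiv, Equiv.coe_addRight,
      AddEquiv.toEquiv_eq_coe, AddEquiv.coe_toEquiv, g.map_adj_iff, h]
    refine and_congr_right fun _ => ?_
    rw [add_right_comm, ← map_add, add_left_inj, θ.injective.eq_iff]

theorem apply_voltageLift (g : Δ ≃g Δ) (θ : N ≃+ N) (h : ∀ u v, ζ (g u) (g v) = θ (ζ u v)) (t : N)
    (x : X) : e (voltageLift hζ e g θ h t x) = (g (e x).1, θ (e x).2 + t) :=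
  e.apply_symm_apply _

theorem voltageLift_symm_apply (g : Δ ≃g Δ) (θ : N ≃+ N) (h : ∀ u v, ζ (g u) (g v) = θ (ζ u v))
    (t : N) (w : W) (s : N) :
    voltageLift hζ e g θ h t (e.symm (w, s)) = e.symm (g w, θ s + t) := by
  rw [Equiv.eq_symm_apply, apply_voltageLift, Equiv.apply_symm_apply]

/-- The covering transformation of a voltage cover given by the translation by `t`. -/
def voltageTranslation (t : N) : voltageGraph Δ ζ hζ e ≃g voltageGraph Δ ζ hζ e :=
  voltageLift hζ e 1 (AddEquiv.refl N) (fun _ _ => rfl) t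

theorem apply_voltageTranslation (t : N) (x : X) :
    e (voltageTranslation (Δ := Δ) hζ e t x) = ((e x).1, (e x).2 + t) :=
  apply_voltageLift ..

theorem voltageTranslation_symm_apply (t : N) (w : W) (s : N) :
    voltageTranslation (Δ := Δ) hζ e t (e.symm (w, s)) = e.symm (w, s + t) :=
  voltageLift_symm_apply ..

theorem voltageTranslation_mul (s t : N) :
    voltageTranslation (Δ := Δ) hζ e s * voltageTranslation hζ e t
      = voltageTranslation hζ e (t + s) := by
  refine RelIso.ext fun x => e.injective ?_
  rw [RelIso.mul_apply]
  simp only [apply_voltageTranslation, add_assoc]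

theorem voltageTranslation_pow (t : N) (k : ℕ) :
    voltageTranslation (Δ := Δ) hζ e t ^ k = voltageTranslation hζ e (k • t) := by
  induction k with
  | zero =>
    refine RelIso.ext fun x => e.injective ?_
    rw [apply_voltageTranslation]
    simp
  | succ k ih => rw [pow_succ, ih, voltageTranslation_mul, succ_nsmul']

theorem exists_lift_voltageGraph (hθ : ∀ g : Δ ≃g Δ, ∃ θ : N ≃+ N, ∀ u v, ζ (g u) (g v) = θ (ζ u v))
    (g : Δ ≃g Δ) (x y : X) (hxy : (e y).1 = g (e x).1) :
    ∃ h : voltageGraph Δ ζ hζ e ≃g voltageGraph Δ ζ hζ e,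
      (∀ z, (e (h z)).1 = g (e z).1) ∧ h x = y := by
  obtain ⟨θ, h⟩ := hθ g
  refine ⟨voltageLift hζ e g θ h ((e y).2 - θ (e x).2), fun z => ?_, e.injective ?_⟩
  · rw [apply_voltageLift]
  · rw [apply_voltageLift, ← hxy, add_sub_cancel]

theorem isElementaryAbelianCover_voltageGraph (hΓ : (voltageGraph Δ ζ hζ e).Connected) {q : ℕ}
    (hq : q.Prime) (hN : ∀ t : N, q • t = 0) :
    IsElementaryAbelianCover (voltageGraph Δ ζ hζ e)
      (deckGroup (voltageGraph Δ ζ hζ e) fun x => (e x).1) Δ := by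
  have hp := isCoveringProjection_voltageGraph (Δ := Δ) hζ e
  have htr : ∀ t, voltageTranslation (Δ := Δ) hζ e t ∈
      deckGroup (voltageGraph Δ ζ hζ e) fun x => (e x).1 := fun t x => by
    simp only [apply_voltageTranslation]
  have hdeck : ∀ h ∈ deckGroup (voltageGraph Δ ζ hζ e) fun x => (e x).1,
      ∃ t, h = voltageTranslation hζ e t := fun h hh => by
    obtain ⟨x⟩ := hΓ.nonempty
    refine ⟨(e (h x)).2 - (e x).2, eq_of_lifts_agree hp hΓ (x := x) (fun y => ?_)
      (e.injective ?_)⟩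
    · exact (hh y).trans (htr _ y).symm
    · rw [apply_voltageTranslation, add_sub_cancel]
      exact Prod.ext (hh x) rfl
  refine ⟨fun x => (e x).1, hp, fun g => Iff.rfl, fun v w hvw => ?_, ?_, q, hq, ?_⟩
  · refine ⟨voltageTranslation hζ e ((e w).2 - (e v).2), ⟨htr _, e.injective ?_⟩, fun k hk => ?_⟩
    · rw [apply_voltageTranslation, add_sub_cancel]
      exact Prod.ext hvw rfl
    · refine eq_of_lifts_agree hp hΓ (x := v) (fun y => ?_) ?_
      · exact (hk.1 y).trans (htr _ y).symm
      · rw [hk.2]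
        refine e.injective ?_
        rw [apply_voltageTranslation, add_sub_cancel]
        exact Prod.ext hvw.symm rfl
  · intro g hg h hh
    obtain ⟨s, rfl⟩ := hdeck g hg
    obtain ⟨t, rfl⟩ := hdeck h hh
    rw [voltageTranslation_mul, voltageTranslation_mul, add_comm]
  · intro g hg
    obtain ⟨t, rfl⟩ := hdeck g hg
    rw [voltageTranslation_pow, hN, ← pow_zero (voltageTranslation hζ e t),
      voltageTranslation_pow, zero_nsmul]

/-- If the voltages on the edges at a vertex `α` are pairwise distinct, the edges from
`(α, -ζ α β)` to `(β, 0)`, for `β` adjacent to `α`, form a permutable matching: they are permuted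
by the lifts of the stabilizer of `α` that fix the zero section. -/
theorem hasPermutableMatching_voltageGraph (hΔ : IsLocallySym Δ ⊤ m) (hm : m ≠ 0)
    (hθ : ∀ g : Δ ≃g Δ, ∃ θ : N ≃+ N, ∀ u v, ζ (g u) (g v) = θ (ζ u v)) {α : W}
    (hα : ∀ β γ, Δ.Adj α β → Δ.Adj α γ → ζ α β = ζ α γ → β = γ) :
    HasPermutableMatching (voltageGraph Δ ζ hζ e)
      (fibreGroup (voltageGraph Δ ζ hζ e) fun x => (e x).1) m := by
  have : Finite (Δ.neighborSet α) :=
    Set.finite_of_ncard_ne_zero ((hΔ.2 α).1 ▸ hm)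
  let β : Fin m ≃ Δ.neighborSet α := (Finite.equivFinOfCardEq (hΔ.2 α).1).symm
  have hβ : ∀ i, Δ.Adj α (β i) := fun i => (β i).2
  have hinj : ∀ i j, (β i : W) = β j → i = j := fun i j hij => β.injective (Subtype.ext hij)
  refine IsPermutableFamily.hasPermutableMatching (a := fun i => e.symm (α, -ζ α (β i)))
    (b := fun i => e.symm (β i, 0)) ⟨fun i => ?_, fun i j hij => ⟨fun h => ?_, fun h => ?_,
      fun h => ?_⟩, fun π => ?_⟩
  · rw [voltageGraph_adj_symm_apply]
    exact ⟨hβ i, by simp⟩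
  · rw [e.symm.injective.eq_iff, Prod.mk_right_inj, neg_inj] at h
    exact hij (hinj i j (hα _ _ (hβ i) (hβ j) h))
  · rw [e.symm.injective.eq_iff, Prod.mk_left_inj] at h
    exact hij (hinj i j h)
  · rw [e.symm.injective.eq_iff, Prod.mk_inj] at h
    exact (hβ j).ne h.1
  · obtain ⟨g, -, hgα, hg⟩ := (hΔ.2 α).2 ((β.symm.trans π).trans β)
    have hg' : ∀ i, g (β i) = β (π i) := fun i => by simpa using hg (β i)
    obtain ⟨θ, h⟩ := hθ g
    refine ⟨voltageLift hζ e g θ h 0, mem_fibreGroup_of_lift (Δ := Δ) (g := g) fun x => ?_,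
      fun i => ?_⟩
    · rw [apply_voltageLift]
    · rw [voltageLift_symm_apply, voltageLift_symm_apply, map_neg, ← h, hgα, hg', map_zero,
        add_zero, add_zero]

/-- The voltage cover is connected as soon as no nonzero functional turns the voltages into the
differences of a potential on the vertices. -/
theorem voltageGraph_connected {q : ℕ} [Fact q.Prime] [Module (ZMod q) N] (hΔ : Δ.Connected)
    (hψ : ∀ ψ : Module.Dual (ZMod q) N,
      (∃ f : W → ZMod q, ∀ u v, Δ.Adj u v → ψ (ζ u v) = f v - f u) → ψ = 0) :
    (voltageGraph Δ ζ hζ e).Connected := by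
  obtain ⟨w₀⟩ := hΔ.nonempty
  -- `R s v t`: the vertices `(w₀, s)` and `(v, t)` lie in the same connected component.
  let R : N → W → N → Prop := fun s v t =>
    (voltageGraph Δ ζ hζ e).Reachable (e.symm (w₀, s)) (e.symm (v, t))
  have hR : ∀ {s v t} (r : N), R s v t → R (s + r) v (t + r) := fun r h => by
    have := h.map (voltageTranslation (Δ := Δ) hζ e r).toHom
    simpa [R, voltageTranslation_symm_apply] using this
  have hstep : ∀ {s v t u}, Δ.Adj v u → R s v t → R s u (t + ζ v u) := fun hvu h =>
    h.trans (SimpleGraph.Adj.reachable ((voltageGraph_adj_symm_apply hζ e).2 ⟨hvu, rfl⟩))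
  have hdiff : ∀ {v s t}, R 0 v s → R 0 v t → R 0 w₀ (s - t) := fun {v s t} hs ht => by
    have h1 := hR (s - t) ht
    rw [zero_add, add_sub_cancel] at h1
    exact hs.trans h1.symm
  have hex : ∀ v, ∃ t, R 0 v t := forall_of_connected hΔ w₀
    ⟨0, SimpleGraph.Reachable.refl _⟩ fun y z hyz ⟨t, ht⟩ => ⟨_, hstep hyz ht⟩
  -- The voltages of the closed walks at `w₀`.
  let H : AddSubgroup N :=
    { carrier := {t | R 0 w₀ t}
      zero_mem' := SimpleGraph.Reachable.refl _
      add_mem' := fun {s t} hs ht => by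
        have h1 := hR s ht
        rw [zero_add, add_comm] at h1
        exact hs.trans h1
      neg_mem' := fun {t} ht => by
        have h1 := hdiff (SimpleGraph.Reachable.refl _) ht
        rwa [zero_sub] at h1 }
  have hH : ∀ t, t ∈ H := by
    by_contra! hH
    obtain ⟨s, hs⟩ := hH
    obtain ⟨ψ, hψs, hψH⟩ := Submodule.exists_le_ker_of_notMem (K := ZMod q)
      (p := AddSubgroup.toZModSubmodule q H) (v := s) hs
    choose x hx using hex
    refine hψs ?_
    rw [hψ ψ ⟨fun v => ψ (x v), fun u v huv => ?_⟩, LinearMap.zero_apply]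
    have h1 : ψ (x u + ζ u v - x v) = 0 := hψH (hdiff (hstep huv (hx u)) (hx v))
    rw [map_sub, map_add] at h1
    linear_combination h1
  have h0 : ∀ y, (voltageGraph Δ ζ hζ e).Reachable (e.symm (w₀, 0)) y := fun y => by
    obtain ⟨⟨v, t⟩, rfl⟩ := e.symm.surjective y
    obtain ⟨s, hs⟩ := hex v
    have h1 := hR (t - s) hs
    rw [zero_add, add_sub_cancel] at h1
    exact SimpleGraph.Reachable.trans (hH (t - s)) h1
  have : Nonempty X := ⟨e.symm (w₀, 0)⟩
  exact ⟨fun y z => (h0 y).symm.trans (h0 z)⟩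

end Voltage

/-! ### Harmonic functions modulo a prime -/

open Matrix in
/-- On a finite connected graph, a function with values in `ZMod q` whose value at each vertex is
the average over the neighbours (in the form `∑ (f w - f u) = 0`) is constant, for all primes `q`
outside a finite set: those dividing a nonzero integer `D`. -/
theorem exists_forall_harmonic_const {W : Type*} [Fintype W] {Δ : SimpleGraph W}
    [DecidableRel Δ.Adj] (hΔ : Δ.Connected) :
    ∃ D : ℤ, D ≠ 0 ∧ ∀ q : ℕ, q.Prime → ¬ (q : ℤ) ∣ D → ∀ f : W → ZMod q,
      (∀ u, ∑ w ∈ Δ.neighborFinset u, (f w - f u) = 0) → ∀ u v, f u = f v := by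
  classical
  -- The sum of the Laplacian and the all-ones matrix is nonsingular in characteristic zero.
  let A : Matrix W W ℤ := Δ.lapMatrix ℤ + Matrix.of fun _ _ => 1
  have hcard : (Fintype.card W : ℤ) ≠ 0 := by
    have := hΔ.nonempty
    exact_mod_cast Fintype.card_ne_zero
  have hA : A.det ≠ 0 := by
    intro h0
    obtain ⟨x, hx, hAx⟩ := Matrix.exists_mulVec_eq_zero_iff.2 h0
    have hall : ∀ u, (Δ.lapMatrix ℤ *ᵥ x) u + ∑ w, x w = 0 := fun u => by
      have := congrFun hAx u
      rw [Matrix.add_mulVec, Pi.add_apply] at this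
      simpa [Matrix.mulVec, dotProduct] using this
    have hlap : ∑ u, (Δ.lapMatrix ℤ *ᵥ x) u = 0 := by
      have h1 : (1 : W → ℤ) ⬝ᵥ (Δ.lapMatrix ℤ *ᵥ x) = 0 := by
        rw [Matrix.dotProduct_mulVec, ← Matrix.mulVec_transpose, SimpleGraph.isSymm_lapMatrix ℤ Δ]
        have h2 := Δ.lapMatrix_mulVec_const_eq_zero (R := ℤ)
        change (Δ.lapMatrix ℤ *ᵥ fun _ => 1) ⬝ᵥ x = 0
        rw [h2, zero_dotProduct]
      simpa [dotProduct] using h1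
    have hsum : ∑ w, x w = 0 := by
      have h1 : ∑ u : W, ((Δ.lapMatrix ℤ *ᵥ x) u + ∑ w, x w) = 0 :=
        Finset.sum_eq_zero fun u _ => hall u
      rw [Finset.sum_add_distrib, hlap, zero_add, Finset.sum_const, Finset.card_univ,
        nsmul_eq_mul] at h1
      exact (mul_eq_zero.1 h1).resolve_left hcard
    have hconst : ∀ u v, x u = x v := fun u v => by
      have h1 : Δ.lapMatrix ℝ *ᵥ (fun u => (x u : ℝ)) = 0 := by
        funext u
        have h2 := hall u
        rw [hsum, add_zero, SimpleGraph.lapMatrix_mulVec_apply] at h2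
        rw [SimpleGraph.lapMatrix_mulVec_apply, Pi.zero_apply]
        exact_mod_cast h2
      have h2 := Δ.lapMatrix_mulVec_eq_zero_iff_forall_reachable.1 h1 u v (hΔ.preconnected u v)
      exact_mod_cast h2
    refine hx (funext fun u => ?_)
    rw [Finset.sum_congr rfl fun w _ => hconst w u, Finset.sum_const, Finset.card_univ,
      nsmul_eq_mul] at hsum
    exact (mul_eq_zero.1 hsum).resolve_left hcard
  refine ⟨Fintype.card W * A.det, mul_ne_zero hcard hA, fun q hq hqD f hf => ?_⟩
  have : Fact q.Prime := ⟨hq⟩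
  have hn : (Fintype.card W : ZMod q) ≠ 0 := fun h => hqD (Dvd.dvd.mul_right (by
    rw [← ZMod.intCast_zmod_eq_zero_iff_dvd]; exact_mod_cast h) _)
  have hdet : (A.map (Int.castRingHom (ZMod q))).det ≠ 0 := by
    rw [← RingHom.mapMatrix_apply, ← RingHom.map_det]
    exact fun h => hqD (Dvd.dvd.mul_left ((ZMod.intCast_zmod_eq_zero_iff_dvd _ _).1 h) _)
  -- Shift a multiple of `f` so that its sum vanishes; then it lies in the kernel of the matrix.
  let f' : W → ZMod q := fun u => Fintype.card W * f u - ∑ w, f w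
  have hf' : f' = 0 := by
    by_contra hne
    refine hdet (Matrix.exists_mulVec_eq_zero_iff.1 ⟨f', hne, funext fun u => ?_⟩)
    have hmap : A.map (Int.castRingHom (ZMod q))
        = Δ.lapMatrix (ZMod q) + Matrix.of fun _ _ => 1 := by
      ext u v
      simp [A, SimpleGraph.lapMatrix, SimpleGraph.degMatrix, SimpleGraph.adjMatrix_apply,
        Matrix.diagonal_apply, apply_ite (Int.cast : ℤ → ZMod q)]
    have hsum : ∑ w, f' w = 0 := by
      simp only [f', Finset.sum_sub_distrib, ← Finset.mul_sum, Finset.sum_const, Finset.card_univ,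
        nsmul_eq_mul, sub_self]
    have hones : ((Matrix.of fun _ _ => 1 : Matrix W W (ZMod q)) *ᵥ f') u = 0 := by
      simpa [Matrix.mulVec, dotProduct] using hsum
    rw [hmap, Matrix.add_mulVec, Pi.add_apply, hones, add_zero, SimpleGraph.lapMatrix_mulVec_apply]
    have h1 := hf u
    rw [Finset.sum_sub_distrib, Finset.sum_const, SimpleGraph.card_neighborFinset_eq_degree,
      nsmul_eq_mul] at h1
    simp only [f', Finset.sum_sub_distrib, ← Finset.mul_sum, Finset.sum_const,
      SimpleGraph.card_neighborFinset_eq_degree, nsmul_eq_mul, Pi.zero_apply]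
    linear_combination (-(Fintype.card W : ZMod q)) * h1
  intro u v
  have hu := congrFun hf' u
  have hv := congrFun hf' v
  exact mul_left_cancel₀ hn (by linear_combination hu - hv)

/-! ### The universal flow -/

section Flow

variable {W : Type*} [Fintype W] (Δ : SimpleGraph W) (q : ℕ)

/-- The flows (or cycles) of a graph with coefficients in `ZMod q`: antisymmetric
functions on the pairs of vertices, supported on the edges, with zero net flow at every vertex. -/
def flows : Submodule (ZMod q) (W → W → ZMod q) where
  carrier := {φ | (∀ u v, φ v u = -φ u v) ∧ (∀ u v, ¬ Δ.Adj u v → φ u v = 0) ∧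
    ∀ u, ∑ v, φ u v = 0}
  zero_mem' := ⟨by simp, by simp, by simp⟩
  add_mem' {φ ψ} hφ hψ :=
    ⟨fun u v => by simp only [Pi.add_apply, hφ.1 u v, hψ.1 u v]; ring,
      fun u v huv => by simp [hφ.2.1 u v huv, hψ.2.1 u v huv],
      fun u => by simp [Finset.sum_add_distrib, hφ.2.2 u, hψ.2.2 u]⟩
  smul_mem' c φ hφ :=
    ⟨fun u v => by simp only [Pi.smul_apply, hφ.1 u v, smul_neg],
      fun u v huv => by simp [hφ.2.1 u v huv],
      fun u => by simp [← Finset.mul_sum, hφ.2.2 u]⟩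

variable {Δ q}

/-- Automorphisms act on flows by pullback. -/
def flowPullback (g : Δ ≃g Δ) : flows Δ q →ₗ[ZMod q] flows Δ q where
  toFun φ := ⟨fun u v => φ.1 (g u) (g v), fun _ _ => φ.2.1 _ _,
    fun _ _ huv => φ.2.2.1 _ _ fun h => huv (g.map_adj_iff.1 h),
    fun u => (Equiv.sum_comp g.toEquiv fun v => φ.1 (g u) v).trans (φ.2.2.2 _)⟩
  map_add' _ _ := rfl
  map_smul' _ _ := rfl

/-- The pullback of flows along an automorphism, as a linear equivalence. -/
def flowPullbackEquiv (g : Δ ≃g Δ) : flows Δ q ≃ₗ[ZMod q] flows Δ q :=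
  LinearEquiv.ofLinearMap (flowPullback g) (flowPullback g⁻¹)
    (by ext φ u v; simp [flowPullback]) (by ext φ u v; simp [flowPullback])

variable (Δ q) in
/-- The voltage with values in the dual of the space of flows that evaluates each flow on the
given edge. -/
def flowVoltage (u v : W) : Module.Dual (ZMod q) (flows Δ q) where
  toFun φ := φ.1 u v
  map_add' _ _ := rfl
  map_smul' _ _ := rfl

theorem flowVoltage_swap (u v : W) : flowVoltage Δ q v u = -flowVoltage Δ q u v :=
  LinearMap.ext fun φ => φ.2.1 u v

theorem flowVoltage_equivariant (g : Δ ≃g Δ) :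
    ∃ θ : Module.Dual (ZMod q) (flows Δ q) ≃+ Module.Dual (ZMod q) (flows Δ q),
      ∀ u v, flowVoltage Δ q (g u) (g v) = θ (flowVoltage Δ q u v) :=
  ⟨(flowPullbackEquiv g).dualMap.toAddEquiv, fun _ _ => rfl⟩

/-- A functional on the voltages that comes from a potential is a flow that is the gradient of a
harmonic function. -/
theorem eq_zero_of_flowVoltage_potential [Fact q.Prime] [DecidableRel Δ.Adj]
    (hharm : ∀ f : W → ZMod q, (∀ u, ∑ w ∈ Δ.neighborFinset u, (f w - f u) = 0) →
      ∀ u v, f u = f v)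
    (ψ : Module.Dual (ZMod q) (Module.Dual (ZMod q) (flows Δ q))) {f : W → ZMod q}
    (hf : ∀ u v, Δ.Adj u v → ψ (flowVoltage Δ q u v) = f v - f u) : ψ = 0 := by
  obtain ⟨φ, rfl⟩ := (Module.evalEquiv (ZMod q) (flows Δ q)).surjective ψ
  have hφ : ∀ u v, Δ.Adj u v → φ.1 u v = f v - f u := hf
  have hconst := hharm f fun u => by
    rw [← φ.2.2.2 u, ← Finset.sum_subset (Finset.subset_univ (Δ.neighborFinset u)) fun w _ hw =>
      φ.2.2.1 u w fun h => hw ((Δ.mem_neighborFinset u w).2 h)]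
    exact Finset.sum_congr rfl fun w hw => (hφ u w ((Δ.mem_neighborFinset u w).1 hw)).symm
  have h0 : φ = 0 := by
    ext u v
    by_cases huv : Δ.Adj u v
    · rw [hφ u v huv, hconst u v, sub_self]
      rfl
    · exact φ.2.2.1 u v huv
  rw [h0, map_zero]

/-- The flow around the closed walk `α, β, δ, κ, α` separates the voltages of the edges from `α` to
`β` and to a further neighbour `γ`. -/
theorem flowVoltage_ne [Fact q.Prime] {α β γ δ κ : W} (hαβ : Δ.Adj α β) (hβδ : Δ.Adj β δ)
    (hδκ : Δ.Adj δ κ) (hκα : Δ.Adj κ α) (hαγ : Δ.Adj α γ) (hβγ : β ≠ γ) (hδα : δ ≠ α) (hκβ : κ ≠ β)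
    (hκγ : κ ≠ γ) : flowVoltage Δ q α β ≠ flowVoltage Δ q α γ := by
  classical
  let c : W → W → W → W → ZMod q := fun a b u v =>
    (if u = a then 1 else 0) * (if v = b then 1 else 0)
      - (if u = b then 1 else 0) * (if v = a then 1 else 0)
  have hanti : ∀ a b u v, c a b v u = -c a b u v := fun a b u v => by simp only [c]; ring
  have hsupp : ∀ a b, Δ.Adj a b → ∀ u v, ¬ Δ.Adj u v → c a b u v = 0 := fun a b hab u v huv => by
    have h1 : ¬ (u = a ∧ v = b) := fun h => huv (h.1 ▸ h.2 ▸ hab)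
    have h2 : ¬ (u = b ∧ v = a) := fun h => huv (h.1 ▸ h.2 ▸ hab.symm)
    simp only [c, ← ite_and, mul_ite, mul_one, mul_zero, and_comm] at *
    grind
  have hsum : ∀ a b u, ∑ v, c a b u v = (if u = a then 1 else 0) - (if u = b then 1 else 0) :=
    fun a b u => by simp [c, Finset.sum_sub_distrib]
  let φ : flows Δ q := ⟨fun u v => c α β u v + c β δ u v + c δ κ u v + c κ α u v,
    fun u v => by simp only [hanti _ _ u v]; ring,
    fun u v huv => by simp [hsupp _ _ hαβ u v huv, hsupp _ _ hβδ u v huv, hsupp _ _ hδκ u v huv,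
      hsupp _ _ hκα u v huv],
    fun u => by simp only [Finset.sum_add_distrib, hsum]; ring⟩
  intro h
  have h1 : c α β α β + c β δ α β + c δ κ α β + c κ α α β
      = c α β α γ + c β δ α γ + c δ κ α γ + c κ α α γ := LinearMap.congr_fun h φ
  simp [c, hαβ.ne, hδα.symm, hκα.ne', hκβ.symm, hβγ.symm, hκγ.symm, hαβ.ne', hαγ.ne'] at h1

end Flow

/-- A finite connected graph that is locally `S_m` and has enough `4`-cycles has arbitrarily large
elementary abelian regular covers with a permutable `m`-matching. If it has no such matching
itself, these covers lose it in the normal quotient. -/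
theorem exists_cover_losesPermutableMatching {W : Type*} [Finite W] {Δ : SimpleGraph W} {m : ℕ}
    (hm : 3 ≤ m) (hΔ : Δ.Connected) (hsym : IsLocallySym Δ ⊤ m)
    (hcyc : ∃ α, ∀ β γ, Δ.Adj α β → Δ.Adj α γ → β ≠ γ →
      ∃ δ κ, Δ.Adj β δ ∧ Δ.Adj δ κ ∧ Δ.Adj κ α ∧ δ ≠ α ∧ κ ≠ β ∧ κ ≠ γ)
    (hno : ¬ HasPermutableMatching Δ ⊤ m) (B : ℕ) :
    ∃ n : ℕ, B < n ∧ ∃ (Γ : SimpleGraph (Fin n)) (G N : Subgroup (Γ ≃g Γ)),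
      LosesPermutableMatching m Γ G N ∧ IsElementaryAbelianCover Γ N Δ := by
  classical
  have := Fintype.ofFinite W
  obtain ⟨α, hα⟩ := hcyc
  obtain ⟨D, hD, hharm⟩ := exists_forall_harmonic_const hΔ
  obtain ⟨q, hqB, hq⟩ := Nat.exists_infinite_primes (max (B + 1) (D.natAbs + 1))
  have : Fact q.Prime := ⟨hq⟩
  have hqD : ¬ (q : ℤ) ∣ D := fun h => by
    have h1 := Int.natAbs_le_of_dvd_ne_zero h hD
    rw [Int.natAbs_natCast] at h1
    have := le_max_right (B + 1) (D.natAbs + 1)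
    omega
  let N := Module.Dual (ZMod q) (flows Δ q)
  have hsep : ∀ β γ, Δ.Adj α β → Δ.Adj α γ → flowVoltage Δ q α β = flowVoltage Δ q α γ → β = γ :=
    fun β γ hβ hγ h => by
      by_contra hne
      obtain ⟨δ, κ, h1, h2, h3, h4, h5, h6⟩ := hα β γ hβ hγ hne
      exact flowVoltage_ne hβ h1 h2 h3 hγ hne h4 h5 h6 h
  obtain ⟨t, ht⟩ : ∃ t : N, t ≠ 0 := by
    have hcard := (hsym.2 α).1
    obtain ⟨β, hβ, γ, hγ, hne⟩ :=
      (Set.one_lt_ncard_iff_nontrivial).1 (show 1 < (Δ.neighborSet α).ncard by omega)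
    by_contra! h
    exact hne (hsep β γ hβ hγ ((h _).trans (h _).symm))
  have hqN : ∀ s : N, q • s = 0 := fun s => by
    rw [← Nat.cast_smul_eq_nsmul (ZMod q), CharP.cast_eq_zero, zero_smul]
  have : Finite N := Finite.of_injective (fun s : N => (s : flows Δ q → ZMod q)) DFunLike.coe_injective
  have hcardN : q ∣ Nat.card N := by
    have h1 : addOrderOf t = q :=
      ((Nat.dvd_prime hq).1 (addOrderOf_dvd_of_nsmul_eq_zero (hqN t))).resolve_left
        fun h => ht (AddMonoid.addOrderOf_eq_one_iff.1 h)
    exact h1 ▸ addOrderOf_dvd_natCard t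
  obtain ⟨w₀⟩ := hΔ.nonempty
  let e : Fin (Nat.card (W × N)) ≃ W × N := (Finite.equivFin _).symm
  have hconn : (voltageGraph Δ (flowVoltage Δ q) flowVoltage_swap e).Connected :=
    voltageGraph_connected (q := q) flowVoltage_swap e hΔ fun ψ ⟨f, hf⟩ =>
      eq_zero_of_flowVoltage_potential (hharm q hq hqD) ψ hf
  refine ⟨Nat.card (W × N), ?_, voltageGraph Δ (flowVoltage Δ q) flowVoltage_swap e, _, _,
    losesPermutableMatching_of_cover hm (isCoveringProjection_voltageGraph _ e) hconn hsym
      (exists_lift_voltageGraph _ e flowVoltage_equivariant)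
      (hasPermutableMatching_voltageGraph _ e hsym (by omega) flowVoltage_equivariant hsep) hno
      ⟨e.symm (w₀, 0), e.symm (w₀, t), ?_, ?_⟩,
    isElementaryAbelianCover_voltageGraph _ e hconn hq hqN⟩
  · have h1 : q ≤ Nat.card N := Nat.le_of_dvd Nat.card_pos hcardN
    have h2 : 0 < Nat.card W := Nat.card_pos_iff.2 ⟨⟨w₀⟩, inferInstance⟩
    have := le_max_left (B + 1) (D.natAbs + 1)
    rw [Nat.card_prod]
    nlinarith
  · simpa using ht.symm
  · simp

/-! ### Flip graphs and their automorphisms -/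

/-- `Δ` is the graph whose edges join each vertex `v` to its images `T i v` under `m` commuting
involutions, such that a vertex `T i (T j v)` with `i ≠ j` determines the set `{i, j}`, and every
permutation of the involutions is induced by automorphisms taking any vertex to any other. The
hypercubes and most folded hypercubes, with the flips of single coordinates, are of this form. -/
structure IsFlipGraph {W : Type*} (Δ : SimpleGraph W) {m : ℕ} (T : Fin m → W → W) : Prop where
  connected : Δ.Connected
  invol : ∀ i v, T i (T i v) = v
  comm : ∀ i j v, T i (T j v) = T j (T i v)
  adj_iff : ∀ u v, Δ.Adj u v ↔ ∃ i, v = T i u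
  index_injective : ∀ i j v, T i v = T j v → i = j
  square : ∀ i j k l v, i ≠ j → k ≠ l → T i (T j v) = T k (T l v) → k = i ∧ l = j ∨ k = j ∧ l = i
  symm : ∀ (α β : W) (π : Equiv.Perm (Fin m)), ∃ g : Δ ≃g Δ, g α = β ∧
    ∀ i v, g (T i v) = T (π i) (g v)

namespace IsFlipGraph

variable {W : Type*} {Δ : SimpleGraph W} {m : ℕ} {T : Fin m → W → W}

theorem adj_flip (hT : IsFlipGraph Δ T) (i : Fin m) (v : W) : Δ.Adj v (T i v) :=
  (hT.adj_iff _ _).2 ⟨i, rfl⟩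

theorem flip_injective (hT : IsFlipGraph Δ T) (i : Fin m) : Function.Injective (T i) :=
  Function.LeftInverse.injective (hT.invol i)

theorem flip_eq_iff (hT : IsFlipGraph Δ T) {i : Fin m} {u v : W} : T i u = v ↔ u = T i v :=
  ⟨fun h => by rw [← h, hT.invol], fun h => by rw [h, hT.invol]⟩

/-- A property of vertices that holds somewhere and is preserved by flips holds everywhere. -/
theorem induction (hT : IsFlipGraph Δ T) {P : W → Prop} (x : W) (hx : P x)
    (h : ∀ y i, P y → P (T i y)) (y : W) : P y :=
  forall_of_connected hT.connected x hx (fun y z hyz hy => by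
    obtain ⟨i, rfl⟩ := (hT.adj_iff y z).1 hyz
    exact h y i hy) y

theorem isLocallySym (hT : IsFlipGraph Δ T) : IsLocallySym Δ ⊤ m := by
  refine ⟨fun α β => ?_, fun α => ?_⟩
  · obtain ⟨g, hg, -⟩ := hT.symm α β 1
    exact ⟨g, Subgroup.mem_top g, hg⟩
  · have hinj : Function.Injective fun i => T i α := fun i j => hT.index_injective i j α
    have hset : Δ.neighborSet α = Set.range fun i => T i α := by
      ext v
      rw [SimpleGraph.mem_neighborSet, hT.adj_iff]
      simp [eq_comm]
    rw [hset]
    refine ⟨by rw [Set.ncard_range_of_injective hinj, Nat.card_fin], fun σ => ?_⟩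
    let e : Fin m ≃ Set.range fun i => T i α := Equiv.ofInjective _ hinj
    have he : ∀ i, (e i : W) = T i α := fun i => rfl
    obtain ⟨g, hgα, hg⟩ := hT.symm α α ((e.trans σ).trans e.symm)
    refine ⟨g, Subgroup.mem_top g, hgα, fun x => ?_⟩
    obtain ⟨i, rfl⟩ := e.surjective x
    rw [he, hg, hgα, ← he]
    simp

theorem exists_fourCycle (hT : IsFlipGraph Δ T) (hm : 3 ≤ m) (α β γ : W) (hβ : Δ.Adj α β)
    (hγ : Δ.Adj α γ) (hne : β ≠ γ) :
    ∃ δ κ, Δ.Adj β δ ∧ Δ.Adj δ κ ∧ Δ.Adj κ α ∧ δ ≠ α ∧ κ ≠ β ∧ κ ≠ γ := by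
  obtain ⟨i, rfl⟩ := (hT.adj_iff _ _).1 hβ
  obtain ⟨j, rfl⟩ := (hT.adj_iff _ _).1 hγ
  obtain ⟨k, hk⟩ := Finset.exists_mem_notMem_of_card_lt_card
    (s := {i, j}) (t := (Finset.univ : Finset (Fin m)))
    (lt_of_le_of_lt Finset.card_le_two (by simpa using Nat.lt_of_succ_le hm))
  simp only [Finset.mem_univ, Finset.mem_insert, Finset.mem_singleton, not_or, true_and] at hk
  refine ⟨T k (T i α), T k α, hT.adj_flip k _, ?_, (hT.adj_flip k α).symm, fun h => ?_,
    fun h => hk.1 (hT.index_injective _ _ _ h), fun h => hk.2 (hT.index_injective _ _ _ h)⟩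
  · rw [hT.comm]
    exact (hT.adj_flip i _).symm
  · exact hk.1 (hT.index_injective _ _ _ (hT.flip_eq_iff.1 h)).symm

/-- Every automorphism permutes the flips: the image of a `4`-cycle is a `4`-cycle, so the
permutation of the flips induced at a vertex is also induced at each of its neighbours. -/
theorem exists_perm (hT : IsFlipGraph Δ T) (g : Δ ≃g Δ) :
    ∃ π : Equiv.Perm (Fin m), ∀ i v, g (T i v) = T (π i) (g v) := by
  have hex : ∀ v i, ∃ j, g (T i v) = T j (g v) := fun v i =>
    (hT.adj_iff _ _).1 (g.map_adj_iff.2 (hT.adj_flip i v))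
  choose p hp using hex
  have hinj : ∀ v, Function.Injective (p v) := fun v i j hij =>
    hT.index_injective i j v (g.injective (by rw [hp, hp, hij]))
  have hself : ∀ v s, p (T s v) s = p v s := fun v s => by
    refine hT.index_injective _ _ (g (T s v)) ?_
    rw [← hp, hT.invol, hp, hT.invol]
  have hstep : ∀ v s t, p (T s v) t = p v t := fun v s t => by
    rcases eq_or_ne t s with rfl | hts
    · exact hself v t
    · have h1 : T (p (T s v) t) (T (p v s) (g v)) = T (p (T t v) s) (T (p v t) (g v)) := by
        rw [← hp, ← hp, ← hp, ← hp, hT.comm]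
      have hne1 : p (T s v) t ≠ p v s := fun h => hts (hinj _ (h.trans (hself v s).symm))
      have hne2 : p (T t v) s ≠ p v t := fun h => hts (hinj _ (h.trans (hself v t).symm)).symm
      rcases hT.square _ _ _ _ _ hne1 hne2 h1 with h | h
      · exact absurd (hinj v h.2) hts
      · exact h.2.symm
  obtain ⟨v₀⟩ := hT.connected.nonempty
  refine ⟨Equiv.ofBijective (p v₀) (Finite.injective_iff_bijective.1 (hinj v₀)), fun i v => ?_⟩
  have hconst : p v = p v₀ := hT.induction (P := fun v => p v = p v₀) v₀ rfl
    (fun y s hy => (funext (hstep y s)).trans hy) v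
  rw [hp, hconst]
  rfl

/-- Automorphisms that commute with all flips commute with each other, because each of them is a
composition of flips. -/
theorem commute_of_commute_flips (hT : IsFlipGraph Δ T) {h k : W → W}
    (hh : ∀ i v, h (T i v) = T i (h v)) (hk : ∀ i v, k (T i v) = T i (k v)) (v : W) :
    k (h v) = h (k v) := by
  obtain ⟨v₀⟩ := hT.connected.nonempty
  have hword : ∀ y, ∃ w : W → W, w v₀ = y ∧
      ∀ f : W → W, (∀ i v, f (T i v) = T i (f v)) → ∀ v, f (w v) = w (f v) :=
    hT.induction v₀ ⟨id, rfl, fun _ _ _ => rfl⟩ fun y i ⟨w, hw, hf⟩ =>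
      ⟨T i ∘ w, congrArg (T i) hw, fun f hft v => by
        rw [Function.comp_apply, Function.comp_apply, hft, hf f hft]⟩
  obtain ⟨w, hw, hf⟩ := hword (h v₀)
  have heq : ∀ v, h v = w v := hT.induction v₀ hw.symm fun y i hy => by
    rw [hh, hy, hf (T i) fun j v => hT.comm i j v]
  rw [heq, heq, hf k hk]

end IsFlipGraph

/-! ### Flip graphs have no permutable matchings -/

/-- For `m ≥ 5`, a permutation of `m` points that commutes with all its conjugates is trivial: the
symmetric group has no nontrivial abelian normal subgroup. -/
theorem perm_eq_one_of_commute_conj {m : ℕ} (hm : 5 ≤ m) {τ : Equiv.Perm (Fin m)}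
    (h : ∀ σ : Equiv.Perm (Fin m), Commute τ (σ * τ * σ⁻¹)) : τ = 1 := by
  have hfresh : ∀ a b c d : Fin m, ∃ e, e ≠ a ∧ e ≠ b ∧ e ≠ c ∧ e ≠ d := fun a b c d => by
    obtain ⟨e, -, he⟩ := Finset.exists_mem_notMem_of_card_lt_card
      (s := {a, b, c, d}) (t := (Finset.univ : Finset (Fin m)))
      (lt_of_le_of_lt Finset.card_le_four (by simpa using Nat.lt_of_succ_le hm))
    simp only [Finset.mem_insert, Finset.mem_singleton, not_or] at he
    exact ⟨e, he⟩
  by_contra hne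
  obtain ⟨a, ha⟩ : ∃ a, τ a ≠ a := by
    by_contra! h'
    exact hne (Equiv.ext h')
  obtain ⟨b, hb⟩ : ∃ b, τ a = b := ⟨_, rfl⟩
  rw [hb] at ha
  -- Evaluating the commutation at `a`, for a conjugating permutation that fixes `a`.
  have key : ∀ σ : Equiv.Perm (Fin m), σ a = a → σ (τ (σ⁻¹ b)) = τ (σ b) := fun σ hσ => by
    have h1 := DFunLike.congr_fun (h σ).eq a
    have h2 : σ⁻¹ a = a := by rw [Equiv.Perm.inv_eq_iff_eq, hσ]
    simpa [Equiv.Perm.mul_apply, h2, hb] using h1.symm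
  have hτb : τ b = a := by
    by_contra hba
    have hbb : τ b ≠ b := fun h' => ha (τ.injective (h'.trans hb.symm))
    obtain ⟨e, h1, h2, h3, -⟩ := hfresh a b (τ b) a
    have h4 := key (Equiv.swap (τ b) e) (Equiv.swap_apply_of_ne_of_ne (Ne.symm hba) h1.symm)
    rw [Equiv.swap_inv, Equiv.swap_apply_of_ne_of_ne hbb.symm h2.symm,
      Equiv.swap_apply_left] at h4
    exact h3 h4
  obtain ⟨c, hca, hcb, -⟩ := hfresh a b a b
  have hda : τ c ≠ a := fun h' => hcb (τ.injective (h'.trans hτb.symm))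
  have hdb : τ c ≠ b := fun h' => hca (τ.injective (h'.trans hb.symm))
  have hdc : τ c ≠ c := fun h' => by
    have h4 := key (Equiv.swap b c) (Equiv.swap_apply_of_ne_of_ne ha.symm hca.symm)
    rw [Equiv.swap_inv, Equiv.swap_apply_left, h', Equiv.swap_apply_right] at h4
    exact hcb h4.symm
  obtain ⟨e, hea, heb, hec, hed⟩ := hfresh a b c (τ c)
  have h4 := key (Equiv.swap b c * Equiv.swap (τ c) e) (by
    rw [Equiv.Perm.mul_apply, Equiv.swap_apply_of_ne_of_ne hda.symm hea.symm,
      Equiv.swap_apply_of_ne_of_ne ha.symm hca.symm])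
  rw [mul_inv_rev, Equiv.swap_inv, Equiv.swap_inv, Equiv.Perm.mul_apply, Equiv.Perm.mul_apply,
    Equiv.Perm.mul_apply, Equiv.swap_apply_left, Equiv.swap_apply_of_ne_of_ne hdc.symm hec.symm,
    Equiv.swap_apply_left, Equiv.swap_apply_of_ne_of_ne heb hec,
    Equiv.swap_apply_of_ne_of_ne hdb.symm heb.symm, Equiv.swap_apply_left] at h4
  exact hed h4

namespace IsFlipGraph

variable {W : Type*} {Δ : SimpleGraph W} {m : ℕ} {T : Fin m → W → W}

/-- An automorphism that exchanges the flips `J` and `L`, fixes the other flips, and agrees at some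
vertex with a map `t` commuting with the flips, agrees everywhere with `t` up to `T J ∘ T L`. -/
theorem eq_or_eq_of_swap (hT : IsFlipGraph Δ T) {g : Δ ≃g Δ} {J L : Fin m}
    (hg : ∀ i v, g (T i v) = T (Equiv.swap J L i) (g v)) {t : W → W}
    (ht : ∀ i v, t (T i v) = T i (t v)) {x : W} (hx : g x = t x) (v : W) :
    g v = t v ∨ g v = T J (T L (t v)) := by
  refine hT.induction (P := fun v => g v = t v ∨ g v = T J (T L (t v))) x (Or.inl hx)
    (fun y i hy => ?_) v
  rw [hg, ht]
  rcases eq_or_ne i J with rfl | hJ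
  · rw [Equiv.swap_apply_left]
    rcases hy with hy | hy
    · exact Or.inr (by rw [hy, hT.comm L, hT.invol])
    · exact Or.inl (by rw [hy, hT.comm L, hT.invol])
  · rcases eq_or_ne i L with rfl | hL
    · rw [Equiv.swap_apply_right, hT.invol]
      rcases hy with hy | hy
      · exact Or.inr (by rw [hy])
      · exact Or.inl (by rw [hy, hT.invol])
    · rw [Equiv.swap_apply_of_ne_of_ne hJ hL]
      rcases hy with hy | hy
      · exact Or.inl (by rw [hy])
      · exact Or.inr (by rw [hy, hT.comm i J, hT.comm i L])

/-- In a permutable matching of a flip graph with `m ≥ 5`, the automorphisms commuting with all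
flips act trivially on the edges, since they induce a normal abelian subgroup of the symmetric
group. Hence the permutation of the flips determines that of the edges, all permutations of the
flips occur, and the edges have pairwise different directions. An automorphism exchanging the
directions of two edges and fixing the others then forces these two edges to meet. -/
theorem not_hasPermutableMatching (hT : IsFlipGraph Δ T) (hm : 5 ≤ m) :
    ¬ HasPermutableMatching Δ ⊤ m := by
  intro hM
  obtain ⟨a, b, hab⟩ := hM.exists_family (by omega)
  choose d hd using fun i => (hT.adj_iff _ _).1 (hab.adj i)
  choose g _ hg using hab.perm
  choose ρ hρ using fun σ => hT.exists_perm (g σ)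
  have hedge : ∀ i j, s(a i, b i) = s(a j, b j) → i = j := fun i j h => by
    by_contra hne
    have := hab.disjoint i j hne
    rcases Sym2.eq_iff.1 h with h' | h'
    · exact this.1 h'.1
    · exact this.2.2 h'.1
  have hπ : ∀ (π : Equiv.Perm (Fin m)) i, π (π⁻¹ i) = i := fun π i => by simp
  have hπ' : ∀ (π : Equiv.Perm (Fin m)) i, π⁻¹ (π i) = i := fun π i => by simp
  have hρinv : ∀ σ i v, (g σ)⁻¹ (T i v) = T ((ρ σ)⁻¹ i) ((g σ)⁻¹ v) := fun σ i v => by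
    apply (g σ).injective
    rw [hρ, RelIso.apply_inv_self, RelIso.apply_inv_self, hπ]
  have hginv : ∀ σ i, s((g σ)⁻¹ (a i), (g σ)⁻¹ (b i)) = s(a (σ⁻¹ i), b (σ⁻¹ i)) := fun σ i => by
    have h1 := congrArg (Sym2.map ⇑(g σ)⁻¹) (hg σ (σ⁻¹ i))
    simp only [Sym2.map_mk, RelIso.inv_apply_self, hπ] at h1
    exact h1.symm
  -- Automorphisms that commute with all flips fix every edge of the matching.
  have htriv : ∀ (h : Δ ≃g Δ) (τ : Equiv.Perm (Fin m)), (∀ i v, h (T i v) = T i (h v)) →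
      (∀ i, s(h (a i), h (b i)) = s(a (τ i), b (τ i))) → τ = 1 := fun h τ hh hτ => by
    refine perm_eq_one_of_commute_conj hm fun σ => Equiv.ext fun i => hedge _ _ ?_
    have hconj : ∀ i v, g σ (h ((g σ)⁻¹ (T i v))) = T i (g σ (h ((g σ)⁻¹ v))) := fun i v => by
      rw [hρinv, hh, hρ, hπ]
    have hmap : ∀ i, s(g σ (h ((g σ)⁻¹ (a i))), g σ (h ((g σ)⁻¹ (b i))))
        = s(a (σ (τ (σ⁻¹ i))), b (σ (τ (σ⁻¹ i)))) := fun i => by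
      have h1 := congrArg (Sym2.map h) (hginv σ i)
      rw [Sym2.map_mk, Sym2.map_mk, hτ] at h1
      have h2 := congrArg (Sym2.map (g σ)) h1
      rwa [Sym2.map_mk, Sym2.map_mk, hg] at h2
    have hcomm := hT.commute_of_commute_flips (k := fun v => g σ (h ((g σ)⁻¹ v))) hh hconj
    have h1 := congrArg (Sym2.map h) (hmap i)
    have h2 := congrArg (Sym2.map fun v => g σ (h ((g σ)⁻¹ v))) (hτ i)
    rw [Sym2.map_mk, Sym2.map_mk, hτ] at h1
    rw [Sym2.map_mk, Sym2.map_mk, hmap, hcomm, hcomm] at h2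
    exact h1.symm.trans h2
  have hρsurj : Function.Surjective ρ := by
    refine Finite.injective_iff_surjective.1 fun σ σ' h => ?_
    have h1 : σ'⁻¹ * σ = 1 := by
      refine htriv ((g σ')⁻¹ * g σ) _ (fun i v => ?_) fun i => ?_
      · rw [RelIso.mul_apply, RelIso.mul_apply, hρ, hρinv, h, hπ']
      · have h1 := congrArg (Sym2.map ⇑(g σ')⁻¹) (hg σ i)
        rwa [Sym2.map_mk, Sym2.map_mk, hginv] at h1
    exact (inv_mul_eq_one.1 h1).symm
  have hend : ∀ σ i, g σ (a i) = a (σ i) ∨ g σ (a i) = b (σ i) := fun σ i => by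
    rcases Sym2.eq_iff.1 (hg σ i) with h | h
    · exact Or.inl h.1
    · exact Or.inr h.1
  have hdir : ∀ σ i, d (σ i) = ρ σ (d i) := fun σ i => by
    have h1 := hg σ i
    rw [hd i, hd (σ i), hρ] at h1
    rcases Sym2.eq_iff.1 h1 with ⟨h2, h3⟩ | ⟨h2, h3⟩
    · rw [h2] at h3
      exact (hT.index_injective _ _ _ h3).symm
    · rw [h2] at h3
      exact hT.index_injective _ _ _ (hT.flip_eq_iff.1 h3)
  have hdinj : Function.Injective d := by
    refine Finite.injective_iff_surjective.2 fun j => ?_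
    obtain ⟨σ, hσ⟩ := hρsurj (Equiv.swap (d ⟨0, by omega⟩) j)
    exact ⟨σ ⟨0, by omega⟩, by rw [hdir, hσ, Equiv.swap_apply_left]⟩
  -- The edges `j` and `l` will be shown to meet; `i` and `k` are two further edges, each of which
  -- leaves two possibilities for the automorphism exchanging `j` and `l`.
  obtain ⟨j, l, i, k, hjl, hji, hjk, hli, hlk, hik⟩ : ∃ j l i k : Fin m,
      j ≠ l ∧ j ≠ i ∧ j ≠ k ∧ l ≠ i ∧ l ≠ k ∧ i ≠ k :=
    ⟨⟨0, by omega⟩, ⟨1, by omega⟩, ⟨2, by omega⟩, ⟨3, by omega⟩, by simp⟩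
  obtain ⟨σ, hσ⟩ := hρsurj (Equiv.swap (d j) (d l))
  have hgσ : ∀ i v, g σ (T i v) = T (Equiv.swap (d j) (d l) i) (g σ v) := hσ ▸ hρ σ
  have hσj : σ j = l := hdinj (by rw [hdir, hσ, Equiv.swap_apply_left])
  have hfix : ∀ n, j ≠ n → l ≠ n → σ n = n := fun n hjn hln => hdinj (by
    rw [hdir, hσ, Equiv.swap_apply_of_ne_of_ne (hdinj.ne hjn.symm) (hdinj.ne hln.symm)])
  have hcase : ∀ n, j ≠ n → l ≠ n → (∀ v, g σ v = v ∨ g σ v = T (d j) (T (d l) v)) ∨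
      ∀ v, g σ v = T (d n) v ∨ g σ v = T (d j) (T (d l) (T (d n) v)) := fun n hjn hln => by
    have h1 := hend σ n
    rw [hfix n hjn hln, hd n] at h1
    rcases h1 with h1 | h1
    · exact Or.inl (hT.eq_or_eq_of_swap hgσ (t := id) (fun _ _ => rfl) h1)
    · exact Or.inr (hT.eq_or_eq_of_swap hgσ (t := T (d n)) (fun i v => hT.comm _ _ _) h1)
  have hQ : ∀ v, g σ v = v ∨ g σ v = T (d j) (T (d l) v) := by
    rcases hcase i hji hli with h | hi
    · exact h
    rcases hcase k hjk hlk with h | hk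
    · exact h
    exfalso
    have hsq : ∀ x y, x ≠ y → j ≠ x → l ≠ x →
        T (d x) (a j) ≠ T (d j) (T (d l) (T (d y) (a j))) := fun x y hxy hjx hlx h => by
      rw [hT.comm (d l), hT.comm (d j), eq_comm, hT.flip_eq_iff] at h
      rcases hT.square _ _ _ _ _ (hdinj.ne hjl) (hdinj.ne hxy.symm) h with h' | h'
      · exact hlx (hdinj h'.2).symm
      · exact hjx (hdinj h'.2).symm
    rcases hi (a j) with h1 | h1 <;> rcases hk (a j) with h2 | h2 <;> rw [h1] at h2
    · exact hik (hdinj (hT.index_injective _ _ _ h2))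
    · exact hsq i k hik hji hli h2
    · exact hsq k i hik.symm hjk hlk h2.symm
    · exact hik (hdinj (hT.index_injective _ _ _
        (hT.flip_injective _ (hT.flip_injective _ h2))))
  have hdis := hab.disjoint j l hjl
  have hdis' := hab.disjoint l j hjl.symm
  have hj := hend σ j
  rw [hσj] at hj
  rcases hQ (a j) with h1 | h1 <;> rw [h1] at hj <;> rcases hj with h2 | h2
  · exact hdis.1 h2
  · exact hdis.2.2 h2
  · rw [hT.comm, ← hd, hT.flip_eq_iff, ← hd] at h2
    exact hdis.2.1 h2
  · rw [hT.comm, hd l, ← hd] at h2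
    exact hdis'.2.2 (hT.flip_injective _ h2).symm

end IsFlipGraph

/-! ### Hypercubes and folded hypercubes -/

section Cubes

variable {m : ℕ}

/-- The map of the hypercube that changes the coordinate `i`. -/
def cubeFlip (i : Fin m) (x : Fin m → Bool) : Fin m → Bool := fun j => xor (x j) (decide (j = i))

theorem hypercube_adj_iff (x y : Fin m → Bool) :
    (hypercube m).Adj x y ↔ ∃ i, y = cubeFlip i x := by
  change hammingDist x y = 1 ↔ _
  rw [hammingDist, Finset.card_eq_one]
  refine exists_congr fun i => ?_
  simp only [Finset.ext_iff, Finset.mem_filter, Finset.mem_univ, true_and, Finset.mem_singleton,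
    funext_iff, cubeFlip]
  refine forall_congr' fun j => ?_
  by_cases h : j = i <;> cases x j <;> cases y j <;> simp [h]

theorem cubeFlip_invol (i : Fin m) (x : Fin m → Bool) : cubeFlip i (cubeFlip i x) = x := by
  funext j; simp [cubeFlip]

theorem cubeFlip_comm (i j : Fin m) (x : Fin m → Bool) :
    cubeFlip i (cubeFlip j x) = cubeFlip j (cubeFlip i x) := by
  funext k; simp only [cubeFlip, Bool.xor_right_comm]

theorem cubeFlip_injective {i j : Fin m} {x : Fin m → Bool} (h : cubeFlip i x = cubeFlip j x) :
    i = j := by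
  have := congrFun h i
  simpa only [cubeFlip, Bool.xor_right_inj, decide_true, true_eq_decide_iff] using this

theorem cubeFlip_square {i j k l : Fin m} {x : Fin m → Bool} (hij : i ≠ j) (hkl : k ≠ l)
    (h : cubeFlip i (cubeFlip j x) = cubeFlip k (cubeFlip l x)) :
    k = i ∧ l = j ∨ k = j ∧ l = i := by
  have hi := congrFun h i
  have hj := congrFun h j
  have hk := congrFun h k
  simp only [cubeFlip, Bool.xor_assoc, Bool.xor_right_inj] at hi hj hk
  grind

theorem hypercube_connected : (hypercube m).Connected := by
  refine ⟨fun x y => ?_⟩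
  have key : ∀ s : Finset (Fin m), (hypercube m).Reachable x fun j => if j ∈ s then y j else x j :=
    fun s => by
      induction s using Finset.induction_on with
      | empty => exact SimpleGraph.Reachable.refl _
      | insert i s hi ih =>
        by_cases hxy : x i = y i
        · convert ih using 2 with j
          grind
        · refine ih.trans (SimpleGraph.Adj.reachable ((hypercube_adj_iff _ _).2 ⟨i, ?_⟩))
          funext j
          rcases eq_or_ne j i with rfl | hj
          · cases hx : x j <;> cases hy : y j <;> simp_all [cubeFlip]
          · simp [cubeFlip, hj]
  simpa using key Finset.univ

/-- The affine map of the hypercube that permutes the coordinates by `π` and takes `α` to `β`. -/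
def cubeAffine (α β : Fin m → Bool) (π : Equiv.Perm (Fin m)) : Equiv.Perm (Fin m → Bool) where
  toFun x j := xor (xor (x (π⁻¹ j)) (α (π⁻¹ j))) (β j)
  invFun y i := xor (xor (y (π i)) (β (π i))) (α i)
  left_inv x := by funext i; simp
  right_inv y := by funext i; simp

theorem cubeAffine_apply (α β : Fin m → Bool) (π : Equiv.Perm (Fin m)) (x : Fin m → Bool)
    (j : Fin m) : cubeAffine α β π x j = xor (xor (x (π⁻¹ j)) (α (π⁻¹ j))) (β j) := rfl

theorem cubeAffine_self (α β : Fin m → Bool) (π : Equiv.Perm (Fin m)) :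
    cubeAffine α β π α = β := by
  funext j; simp [cubeAffine_apply]

theorem cubeAffine_cubeFlip (α β : Fin m → Bool) (π : Equiv.Perm (Fin m)) (i : Fin m)
    (x : Fin m → Bool) :
    cubeAffine α β π (cubeFlip i x) = cubeFlip (π i) (cubeAffine α β π x) := by
  funext j
  have h : decide (π⁻¹ j = i) = decide (j = π i) := by rw [decide_eq_decide, Equiv.Perm.inv_eq_iff_eq]
  simp only [cubeAffine_apply, cubeFlip, h, Bool.xor_assoc, Bool.xor_comm]

/-- A bijection of the vertices that permutes the flips is an automorphism. -/
def isoOfFlips {W : Type*} {Δ : SimpleGraph W} {T : Fin m → W → W}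
    (hΔ : ∀ u v, Δ.Adj u v ↔ ∃ i, v = T i u) (f : Equiv.Perm W) (π : Equiv.Perm (Fin m))
    (hf : ∀ i v, f (T i v) = T (π i) (f v)) : Δ ≃g Δ where
  toEquiv := f
  map_rel_iff' {u v} := by
    rw [hΔ, hΔ, ← π.exists_congr_right]
    simp only [← hf, f.injective.eq_iff]

theorem hypercube_isFlipGraph : IsFlipGraph (hypercube m) cubeFlip where
  connected := hypercube_connected
  invol := cubeFlip_invol
  comm := cubeFlip_comm
  adj_iff := hypercube_adj_iff
  index_injective _ _ _ := cubeFlip_injective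
  square _ _ _ _ _ := cubeFlip_square
  symm α β π := ⟨isoOfFlips hypercube_adj_iff (cubeAffine α β π) π (cubeAffine_cubeFlip α β π),
    cubeAffine_self α β π, cubeAffine_cubeFlip α β π⟩

theorem antipodal_iff {x y : Fin m → Bool} : antipodal m x y ↔ y = x ∨ ∀ i, y i = !(x i) := Iff.rfl

/-- The map of the folded hypercube induced by changing the coordinate `i`. -/
def foldedFlip (i : Fin m) : Quotient (antipodal m) → Quotient (antipodal m) :=
  Quotient.map (cubeFlip i) fun x y h => by
    rcases h with rfl | h
    · exact Or.inl rfl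
    · exact Or.inr fun j => by simp [cubeFlip, h j]

theorem foldedFlip_mk (i : Fin m) (x : Fin m → Bool) :
    foldedFlip i (Quotient.mk (antipodal m) x) = Quotient.mk (antipodal m) (cubeFlip i x) := rfl

theorem foldedFlip_injective (hm : 3 ≤ m) (i j : Fin m) (A : Quotient (antipodal m))
    (h : foldedFlip i A = foldedFlip j A) : i = j := by
  induction A using Quotient.inductionOn with | _ x
  rcases antipodal_iff.1 (Quotient.exact h) with h | h
  · exact (cubeFlip_injective h).symm
  · obtain ⟨n, -, hn⟩ := Finset.exists_mem_notMem_of_card_lt_card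
      (s := {i, j}) (t := (Finset.univ : Finset (Fin m)))
      (lt_of_le_of_lt Finset.card_le_two (by simpa using Nat.lt_of_succ_le hm))
    simp only [Finset.mem_insert, Finset.mem_singleton, not_or] at hn
    have := h n
    simp [cubeFlip, hn] at this

theorem foldedFlip_square (hm : 3 ≤ m) (hm4 : m ≠ 4) (i j k l : Fin m)
    (A : Quotient (antipodal m)) (hij : i ≠ j) (hkl : k ≠ l)
    (h : foldedFlip i (foldedFlip j A) = foldedFlip k (foldedFlip l A)) :
    k = i ∧ l = j ∨ k = j ∧ l = i := by
  induction A using Quotient.inductionOn with | _ x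
  rcases antipodal_iff.1 (Quotient.exact h) with h | h
  · exact cubeFlip_square hij hkl h.symm
  · exfalso
    have h' : ∀ n, xor (xor (decide (n = l)) (decide (n = k)))
        (xor (decide (n = j)) (decide (n = i))) = true := fun n => by
      have := h n
      simp only [cubeFlip] at this
      revert this
      cases x n <;> cases decide (n = i) <;> cases decide (n = j) <;> cases decide (n = k) <;>
        cases decide (n = l) <;> decide
    rcases eq_or_ne m 3 with rfl | hm3
    · clear * - hij hkl h'
      -- Four flips cannot change each of three coordinates an odd number of times.
      revert i j k l
      decide
    · obtain ⟨n, -, hn⟩ := Finset.exists_mem_notMem_of_card_lt_card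
        (s := {i, j, k, l}) (t := (Finset.univ : Finset (Fin m)))
        (lt_of_le_of_lt Finset.card_le_four (by rw [Finset.card_univ, Fintype.card_fin]; omega))
      simp only [Finset.mem_insert, Finset.mem_singleton, not_or] at hn
      have := h' n
      simp [hn] at this

theorem foldedCube_adj_iff (hm : 3 ≤ m) (A B : Quotient (antipodal m)) :
    (foldedCube m).Adj A B ↔ ∃ i, B = foldedFlip i A := by
  constructor
  · rintro ⟨-, x, y, rfl, rfl, hxy⟩
    obtain ⟨i, rfl⟩ := (hypercube_adj_iff x y).1 hxy
    exact ⟨i, rfl⟩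
  · rintro ⟨i, rfl⟩
    induction A using Quotient.inductionOn with | _ x
    refine ⟨fun h => ?_, x, cubeFlip i x, rfl, rfl, (hypercube_adj_iff _ _).2 ⟨i, rfl⟩⟩
    rcases antipodal_iff.1 (Quotient.exact h) with h | h
    · have := congrFun h i
      simp [cubeFlip] at this
    · obtain ⟨n, -, hn⟩ := Finset.exists_mem_notMem_of_card_lt_card
        (s := {i}) (t := (Finset.univ : Finset (Fin m)))
        (by rw [Finset.card_singleton, Finset.card_univ, Fintype.card_fin]; omega)
      have := h n
      simp [cubeFlip, Finset.mem_singleton.not.1 hn] at this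

theorem foldedCube_connected (hm : 3 ≤ m) : (foldedCube m).Connected := by
  let p : hypercube m →g foldedCube m :=
    ⟨Quotient.mk (antipodal m), fun {x y} hxy => by
      obtain ⟨i, rfl⟩ := (hypercube_adj_iff x y).1 hxy
      exact (foldedCube_adj_iff hm _ _).2 ⟨i, rfl⟩⟩
  have : Nonempty (Quotient (antipodal m)) := ⟨Quotient.mk _ fun _ => false⟩
  refine ⟨fun A B => ?_⟩
  induction A, B using Quotient.inductionOn₂ with
  | _ x y => exact (hypercube_connected.preconnected x y).map p

/-- The automorphism of the folded hypercube induced by `cubeAffine`. -/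
def foldedAffine (α β : Fin m → Bool) (π : Equiv.Perm (Fin m)) :
    Equiv.Perm (Quotient (antipodal m)) :=
  Quotient.congr (cubeAffine α β π) fun x y => by
    rw [antipodal_iff, antipodal_iff, (cubeAffine α β π).injective.eq_iff]
    refine or_congr_right ?_
    simp only [cubeAffine_apply]
    rw [← π⁻¹.forall_congr_right (q := fun i => y i = !(x i))]
    refine forall_congr' fun i => ?_
    cases x (π⁻¹ i) <;> cases y (π⁻¹ i) <;> cases α (π⁻¹ i) <;> cases β i <;> decide

theorem foldedAffine_mk (α β : Fin m → Bool) (π : Equiv.Perm (Fin m)) (x : Fin m → Bool) :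
    foldedAffine α β π (Quotient.mk (antipodal m) x)
      = Quotient.mk (antipodal m) (cubeAffine α β π x) := rfl

/-- For `m = 4` the condition on squares fails, as changing two coordinates agrees with changing
the other two up to antipodality. -/
theorem foldedCube_isFlipGraph (hm : 3 ≤ m) (hm4 : m ≠ 4) :
    IsFlipGraph (foldedCube m) foldedFlip where
  connected := foldedCube_connected hm
  invol i A := by
    induction A using Quotient.inductionOn with | _ x
    rw [foldedFlip_mk, foldedFlip_mk, cubeFlip_invol]
  comm i j A := by
    induction A using Quotient.inductionOn with | _ x
    simp only [foldedFlip_mk, cubeFlip_comm i j]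
  adj_iff := foldedCube_adj_iff hm
  index_injective := foldedFlip_injective hm
  square := foldedFlip_square hm hm4
  symm A B π := by
    induction A, B using Quotient.inductionOn₂ with
    | _ α β =>
      have h : ∀ i A, foldedAffine α β π (foldedFlip i A)
          = foldedFlip (π i) (foldedAffine α β π A) := fun i A => by
        induction A using Quotient.inductionOn with | _ x
        rw [foldedFlip_mk, foldedAffine_mk, foldedAffine_mk, foldedFlip_mk, cubeAffine_cubeFlip]
      refine ⟨isoOfFlips (foldedCube_adj_iff hm) (foldedAffine α β π) π h, ?_, h⟩
      exact congrArg _ (cubeAffine_self α β π)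

theorem card_foldedCube_three : Nat.card (Quotient (antipodal 3)) ≤ 4 := by
  have h : Function.Surjective fun p : Bool × Bool =>
      Quotient.mk (antipodal 3) ![false, p.1, p.2] := fun A => by
    induction A using Quotient.inductionOn with | _ x
    refine ⟨(xor (x 0) (x 1), xor (x 0) (x 2)), Quotient.sound (antipodal_iff.2 ?_)⟩
    cases hx : x 0
    · exact Or.inl (funext fun i => by fin_cases i <;> simp [hx])
    · exact Or.inr fun i => by fin_cases i <;> simp [hx]
  simpa using Nat.card_le_card_of_surjective _ h

end Cubes

/-! ### Complete graphs -/

theorem isLocallySym_top (m : ℕ) : IsLocallySym (⊤ : SimpleGraph (Fin (m + 1))) ⊤ m := by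
  classical
  have hiso : ∀ f : Equiv.Perm (Fin (m + 1)),
      ∃ g : (⊤ : SimpleGraph (Fin (m + 1))) ≃g (⊤ : SimpleGraph (Fin (m + 1))), ∀ v, g v = f v :=
    fun f => ⟨⟨f, by simp⟩, fun _ => rfl⟩
  refine ⟨fun α β => ?_, fun α => ⟨?_, fun σ => ?_⟩⟩
  · obtain ⟨g, hg⟩ := hiso (Equiv.swap α β)
    exact ⟨g, Subgroup.mem_top g, by rw [hg, Equiv.swap_apply_left]⟩
  · have h : (⊤ : SimpleGraph (Fin (m + 1))).neighborSet α = {α}ᶜ := by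
      ext; simp [eq_comm]
    rw [h, Set.ncard_compl, Set.ncard_singleton, Nat.card_fin, Nat.add_sub_cancel]
  · obtain ⟨g, hg⟩ := hiso (Equiv.Perm.ofSubtype σ)
    refine ⟨g, Subgroup.mem_top g, ?_, fun β => ?_⟩
    · rw [hg, Equiv.Perm.ofSubtype_apply_of_not_mem σ (by simp)]
    · rw [hg, Equiv.Perm.ofSubtype_apply_coe]

theorem exists_fourCycle_top {m : ℕ} (hm : 3 ≤ m) (α β γ : Fin (m + 1)) (_ : α ≠ β) (hγ : α ≠ γ)
    (hne : β ≠ γ) : ∃ δ κ, (⊤ : SimpleGraph (Fin (m + 1))).Adj β δ ∧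
      (⊤ : SimpleGraph (Fin (m + 1))).Adj δ κ ∧ (⊤ : SimpleGraph (Fin (m + 1))).Adj κ α ∧
      δ ≠ α ∧ κ ≠ β ∧ κ ≠ γ := by
  obtain ⟨κ, -, hκ⟩ := Finset.exists_mem_notMem_of_card_lt_card
    (s := {α, β, γ}) (t := (Finset.univ : Finset (Fin (m + 1))))
    (lt_of_le_of_lt Finset.card_le_three (by rw [Finset.card_univ, Fintype.card_fin]; omega))
  simp only [Finset.mem_insert, Finset.mem_singleton, not_or] at hκ
  exact ⟨γ, κ, hne, Ne.symm hκ.2.2, hκ.1, hγ.symm, hκ.2.1, hκ.2.2⟩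

theorem exists_cover_top (m : ℕ) (hm : 3 ≤ m) (B : ℕ) :
    ∃ n : ℕ, B < n ∧ ∃ (Γ : SimpleGraph (Fin n)) (G N : Subgroup (Γ ≃g Γ)),
      LosesPermutableMatching m Γ G N ∧
      IsElementaryAbelianCover Γ N (⊤ : SimpleGraph (Fin (m + 1))) := by
  refine exists_cover_losesPermutableMatching hm SimpleGraph.connected_top (isLocallySym_top m)
    ⟨0, exists_fourCycle_top hm 0⟩ (fun h => ?_) B
  have := h.two_mul_le_card (by omega)
  rw [Nat.card_fin] at this
  omega

end PermMatch

theorem corollary3p10 (m : ℕ) (hm : 3 ≤ m) :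
    (∀ B : ℕ, ∃ n : ℕ, B < n ∧ ∃ (Γ : SimpleGraph (Fin n)) (G N : Subgroup (Γ ≃g Γ)),
      PermMatch.LosesPermutableMatching m Γ G N) ∧
    (∀ B : ℕ, ∃ n : ℕ, B < n ∧ ∃ (Γ : SimpleGraph (Fin n)) (G N : Subgroup (Γ ≃g Γ)),
      PermMatch.LosesPermutableMatching m Γ G N ∧
      PermMatch.IsElementaryAbelianCover Γ N (⊤ : SimpleGraph (Fin (m + 1)))) ∧
    (5 ≤ m → ∀ B : ℕ, ∃ n : ℕ, B < n ∧ ∃ (Γ : SimpleGraph (Fin n)) (G N : Subgroup (Γ ≃g Γ)),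
      PermMatch.LosesPermutableMatching m Γ G N ∧
      PermMatch.IsElementaryAbelianCover Γ N (PermMatch.hypercube m)) ∧
    (m ≠ 4 → ∀ B : ℕ, ∃ n : ℕ, B < n ∧ ∃ (Γ : SimpleGraph (Fin n)) (G N : Subgroup (Γ ≃g Γ)),
      PermMatch.LosesPermutableMatching m Γ G N ∧
      PermMatch.IsElementaryAbelianCover Γ N (PermMatch.foldedCube m)) := by
  refine ⟨fun B => ?_, PermMatch.exists_cover_top m hm, fun hm5 B => ?_, fun hm4 B => ?_⟩
  · obtain ⟨n, hn, Γ, G, N, h, -⟩ := PermMatch.exists_cover_top m hm B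
    exact ⟨n, hn, Γ, G, N, h⟩
  · have hT := PermMatch.hypercube_isFlipGraph (m := m)
    exact PermMatch.exists_cover_losesPermutableMatching hm hT.connected hT.isLocallySym
      ⟨fun _ => false, hT.exists_fourCycle hm _⟩ (hT.not_hasPermutableMatching hm5) B
  · have hT := PermMatch.foldedCube_isFlipGraph hm hm4
    refine PermMatch.exists_cover_losesPermutableMatching hm hT.connected hT.isLocallySym
      ⟨Quotient.mk _ fun _ => false, hT.exists_fourCycle hm _⟩ ?_ B
    rcases eq_or_ne m 3 with rfl | hm3
    · intro h
      have := h.two_mul_le_card (by omega)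
      have := PermMatch.card_foldedCube_three
      omega
    · exact hT.not_hasPermutableMatching (by omega)
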